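/- Let $(\Omega,\mathcal F,\mathbb P)$ be a complete probability space carrying a one-dimensional standard Brownian motion $B$, and let $(\mathcal F_t)_{t\ge0}$ be its augmented filtration. Fix $\mu,r\in\mathbb R$ and $\sigma,\tau,\gamma,\delta>0$, $\alpha\in(0,1)$, $k\ge0$ such that $\phi:=\frac{\mu-r}{\sigma}\neq0$ and $\delta>h:=r\alpha+\frac{\alpha\phi^2}{2(1-\alpha)}$. Put $Z_\tau:=\exp\big(-\phi B_\tau-(r+\tfrac{\phi^2}{2})\tau\big)$, $U(x):=x^\alpha$ for $x\ge0$ and $U(x):=-k|x|^\alpha$ for $x<0$, and $F(y;\theta):=U(y-\gamma)+\theta y^\alpha$. Let $\mathcal Y$ be the set of $\mathcal F_\tau$-measurable random variables $Y\ge0$ with $\mathbb E[Z_\tau Y]\le1$, and let $\Phi(\theta):=\sup_{Y\in\mathcal Y}\mathbb E[F(Y;\theta)]$. For $\kappa\in[0,1]$ let $\theta^*(\kappa)$ be the unique real number with $\theta^*(\kappa)=e^{-\delta\tau}\Phi(\kappa\theta^*(\kappa))$. Define $$A_{\mathrm{my}}:=\theta^*(0)=e^{-\delta\tau}\sup_{Y\in\mathcal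 Y}\mathbb E[U(Y-\gamma)],\qquad A_{\mathrm{expo}}:=\theta^*(1).$$ For $\beta\in(0,1]$ and $\xi\in[0,e^{h\tau}]$ let $\kappa_\beta(\xi):=\dfrac{\beta}{1-(1-\beta)e^{-\delta\tau}\xi}\in(0,1]$, $\Theta_\beta(\xi):=\kappa_\beta(\xi)\,\theta^*(\kappa_\beta(\xi))$, and $$G_\beta(\xi):=\Big\{\mathbb E[Y^\alpha]\;:\;Y\in\operatorname*{arg\,max}_{Y\in\mathcal Y}\mathbb E\big[F(Y;\Theta_\beta(\xi))\big]\Big\}.$$ A fixed point of $G_\beta$ is a $\hat\xi\in[0,e^{h\tau}]$ with $\hat\xi\in G_\beta(\hat\xi)$; given a choice $\hat\xi$ of such a fixed point, put $A_{\mathrm{so}}(\beta):=\Theta_\beta(\hat\xi)$. 1. If $A_{\mathrm{my}}>0$, then $\beta\mapsto\beta A_{\mathrm{expo}}$ is non-decreasing on $(0,1]$, and $\beta\mapsto A_{\mathrm{so}}(\beta)$ is non-decreasing on the set of those $\beta\in(0,1]$ for which $G_\beta$ has a unique fixed point (so on all of $(0,1]$ if the fixed point is unique for every $\beta$). 2.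 If $A_{\mathrm{my}}<0$, then $\beta\mapsto\beta A_{\mathrm{expo}}$ is non-increasing on $(0,1]$; moreover, for every $\beta\in(0,1]$ the map $G_\beta$ has a fixed point, and $A_{\mathrm{so}}$ is non-increasing on $(0,1]$: if $0<\beta_1\le\beta_2\le1$ and $\hat\xi_1,\hat\xi_2$ are any fixed points of $G_{\beta_1},G_{\beta_2}$, then $\Theta_{\beta_2}(\hat\xi_2)\le\Theta_{\beta_1}(\hat\xi_1)$ (in particular $A_{\mathrm{so}}(\beta)$ does not depend on the choice of the fixed point). -/

import Mathlib

open MeasureTheory ProbabilityTheory Set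
open scoped NNReal ENNReal

namespace PeriodicPortfolio

/-- The parameters of the model, apart from the myopia level `β`: the Black-Scholes market
(`mu`, `r`, `sigma`), the length `τ` of an evaluation period, the benchmark `γ`, the utility
parameters `α` and `k`, and the discount rate `δ`, with the standing assumptions on them. -/
structure Model where
  mu : ℝ
  r : ℝ
  sigma : ℝ
  τ : ℝ
  γ : ℝ
  α : ℝ
  k : ℝ
  δ : ℝ
  sigma_pos : 0 < sigma
  sharpe_ne_zero : (mu - r) / sigma ≠ 0
  τ_pos : 0 < τ
  γ_pos : 0 < γ
  α_pos : 0 < α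
  α_lt_one : α < 1
  k_nonneg : 0 ≤ k
  δ_pos : 0 < δ
  /-- The well-posedness assumption `δ > h` (see `Model.h`). -/
  well_posed : r * α + α * ((mu - r) / sigma) ^ 2 / (2 * (1 - α)) < δ

namespace Model

/-- The Sharpe ratio `φ = (μ - r) / σ`. -/
noncomputable def sharpe (M : Model) : ℝ := (M.mu - M.r) / M.sigma

/-- The constant `h = r α + α φ² / (2 (1 - α))`. -/
noncomputable def h (M : Model) : ℝ :=
  M.r * M.α + M.α * M.sharpe ^ 2 / (2 * (1 - M.α))

/-- The one-period discount factor `e^{-δ τ}`. -/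
noncomputable def disc (M : Model) : ℝ := Real.exp (-(M.δ * M.τ))

/-- The piecewise power utility: `x ^ α` for `x ≥ 0` and `-k |x| ^ α` for `x < 0`. -/
noncomputable def U (M : Model) (x : ℝ) : ℝ :=
  if 0 ≤ x then x ^ M.α else -M.k * |x| ^ M.α

/-- `F(y; θ) = U(y - γ) + θ y ^ α`. -/
noncomputable def F (M : Model) (y θ : ℝ) : ℝ := M.U (y - M.γ) + θ * y ^ M.α

/-- The weight `κ = β / (1 - (1 - β) e^{-δ τ} ξ)`. -/
noncomputable def weight (M : Model) (β ξ : ℝ) : ℝ := β / (1 - (1 - β) * M.disc * ξ)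

end Model

section

variable {Ω : Type*} [MeasurableSpace Ω]

/-- The σ-algebra of the augmented Brownian filtration at time `t`: generated by the increments
`B s - B 0` for `s ≤ t` and by the `P`-null sets. -/
@[reducible] def augmentedSigma (P : Measure Ω) (B : ℝ≥0 → Ω → ℝ) (t : ℝ≥0) : MeasurableSpace Ω :=
  eventuallyMeasurableSpace
    (⨆ s : Iic t, MeasurableSpace.comap (fun ω => B s ω - B 0 ω) inferInstance) (ae P)

/-- The pricing kernel `Z_t = exp(-φ B_t - (r + φ² / 2) t)`. -/
noncomputable def pricingKernel (M : Model) (B : ℝ≥0 → Ω → ℝ) (t : ℝ≥0) (ω : Ω) : ℝ :=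
  Real.exp (-M.sharpe * B t ω - (M.r + M.sharpe ^ 2 / 2) * t)

/-- The set `𝒴` of attainable gross returns over one period: nonnegative, `ℱ_τ`-measurable random
variables with `E[Z_τ Y] ≤ 1`. -/
def returns (M : Model) (P : Measure Ω) (B : ℝ≥0 → Ω → ℝ) : Set (Ω → ℝ) :=
  {Y | Measurable[augmentedSigma P B M.τ.toNNReal] Y ∧ (∀ᵐ ω ∂P, 0 ≤ Y ω) ∧
    ∫⁻ ω, ENNReal.ofReal (pricingKernel M B M.τ.toNNReal ω * Y ω) ∂P ≤ 1}

/-- `E[F(Y; θ)]`. For `Y ∈ 𝒴` the integrand is integrable, since `E[Y ^ α] ≤ e^{h τ}`. -/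
noncomputable def objective (M : Model) (P : Measure Ω) (θ : ℝ) (Y : Ω → ℝ) : ℝ :=
  ∫ ω, M.F (Y ω) θ ∂P

/-- `Φ(θ) = sup_{Y ∈ 𝒴} E[F(Y; θ)]`. -/
noncomputable def Phi (M : Model) (P : Measure Ω) (B : ℝ≥0 → Ω → ℝ) (θ : ℝ) : ℝ :=
  sSup (objective M P θ '' returns M P B)

/-- `θ*(κ)`, for `κ ∈ [0, 1]`: the fixed point of the contraction `θ ↦ e^{-δ τ} Φ(κ θ)`. -/
noncomputable def thetaStar (M : Model) (P : Measure Ω) (B : ℝ≥0 → Ω → ℝ) (κ : ℝ) : ℝ :=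
  Classical.epsilon fun θ => θ = M.disc * Phi M P B (κ * θ)

/-- The value `A_my = e^{-δ τ} sup_{Y ∈ 𝒴} E[U(Y - γ)]` of the completely myopic agent. -/
noncomputable def AMy (M : Model) (P : Measure Ω) (B : ℝ≥0 → Ω → ℝ) : ℝ :=
  M.disc * sSup ((fun Y : Ω → ℝ => ∫ ω, M.U (Y ω - M.γ) ∂P) '' returns M P B)

/-- The value `A_expo = θ*(1)` of the exponential discounter. -/
noncomputable def AExpo (M : Model) (P : Measure Ω) (B : ℝ≥0 → Ω → ℝ) : ℝ :=
  thetaStar M P B 1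

/-- `argmax_{Y ∈ 𝒴} E[F(Y; θ)]`. -/
def maximizers (M : Model) (P : Measure Ω) (B : ℝ≥0 → Ω → ℝ) (θ : ℝ) : Set (Ω → ℝ) :=
  {Y | Y ∈ returns M P B ∧ IsMaxOn (objective M P θ) (returns M P B) Y}

/-- `κ θ*(κ)` with `κ = β / (1 - (1 - β) e^{-δ τ} ξ)`. -/
noncomputable def Theta (M : Model) (P : Measure Ω) (B : ℝ≥0 → Ω → ℝ) (β ξ : ℝ) : ℝ :=
  M.weight β ξ * thetaStar M P B (M.weight β ξ)

/-- The set-valued map `G(ξ) = {E[Y ^ α] : Y ∈ argmax_{Y ∈ 𝒴} E[F(Y; κ θ*(κ))]}` at level `β`. -/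
noncomputable def G (M : Model) (P : Measure Ω) (B : ℝ≥0 → Ω → ℝ) (β ξ : ℝ) : Set ℝ :=
  (fun Y : Ω → ℝ => ∫ ω, (Y ω) ^ M.α ∂P) '' maximizers M P B (Theta M P B β ξ)

/-- The fixed points of `G` on its domain `[0, e^{h τ}]`. -/
def fixedPointsG (M : Model) (P : Measure Ω) (B : ℝ≥0 → Ω → ℝ) (β : ℝ) : Set ℝ :=
  {ξ | ξ ∈ Icc 0 (Real.exp (M.h * M.τ)) ∧ ξ ∈ G M P B β ξ}

/-- The constant `A_so(β) = κ θ*(κ)`, `κ = β / (1 - (1 - β) e^{-δ τ} ξ)`, of the sophisticated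
agent, for the chosen fixed point `ξ` of `G`. -/
noncomputable def ASo (M : Model) (P : Measure Ω) (B : ℝ≥0 → Ω → ℝ) (β ξ : ℝ) : ℝ :=
  Theta M P B β ξ

end

end PeriodicPortfolio

open Filter Topology

namespace PeriodicPortfolio

namespace Model

variable (M : Model)

/-! ### The utility function -/

/-! Write `ρ = e^{-δτ}` and `H = e^{hτ}`. The objective is affine in `θ` with slope `E[Y ^ α]`, and
Hölder's inequality puts this slope in `[0, H]`. Hence `Φ` is convex, non-decreasing and
`H`-Lipschitz, and `ρ H < 1` by well-posedness. The map `θ ↦ ρ Φ(κ θ)` is then a contraction whose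
fixed point has the sign of `Φ(0)`, which settles the claims on `β A_expo`.

For the sophisticated agent the model is reduced to convex analysis on the line: `ξ` is a fixed
point of `G_β` with `Θ = θ` when `ξ ∈ ∂Φ(θ)` and `θ (1 - (1 - β) ρ ξ) = β ρ Φ(θ)`. Equivalently, `θ
(1 - ρ ξ)` is `β ρ` times the intercept of the tangent of slope `ξ` at `θ`. A maximizer gives a
subgradient at once. The converse, `exists_maximizer_of_isSubgradient`, is the main analytic step,
valid if `θ ≥ 0` or `k > 0`. It uses Lagrangian duality with the pointwise demand at price `c Z_τ`.
If the budget binds for some `c`, atomlessness of `Z_τ` makes the demand almost surely unique, and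
its `α`-moment is the only subgradient. Otherwise the free problem `max F(·; θ)` has an affordable
solution and `θ < -1`. Its maximizers are a single point or `{0, y}`; in the latter case every
subgradient is realized by a return of the form `y` on `{Z_τ ≤ t}`, zero elsewhere, or by a
constant.

The graph of `∂Φ` is a continuous curve parametrized by `θ + ξ`, so solutions come from the
intermediate value theorem. If `Φ(0) < 0` this gives existence (`exists_isSubgradient_of_neg`), and
a comparison of tangents gives monotonicity for all fixed points (`le_of_isSubgradient_of_neg`). If
`Φ(0) > 0`, a solution for `β₂` is a barrier below which a solution for `β₁ ≤ β₂` exists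
(`exists_isSubgradient_of_pos`); uniqueness at `β₁` identifies it. -/

lemma U_continuous : Continuous M.U := by
  have hα := M.α_pos
  unfold U
  refine Continuous.if_le ?_ ?_ continuous_const continuous_id ?_
  · exact continuous_id.rpow_const fun _ => Or.inr hα.le
  · exact continuous_const.mul (continuous_abs.rpow_const fun _ => Or.inr hα.le)
  · intro x hx
    subst hx
    simp [Real.zero_rpow hα.ne']

lemma F_continuous : Continuous fun q : ℝ × ℝ => M.F q.1 q.2 := by
  have hα := M.α_pos
  unfold F
  refine (M.U_continuous.comp (continuous_fst.sub continuous_const)).add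
    (continuous_snd.mul (continuous_fst.rpow_const fun _ => Or.inr hα.le))

lemma U_of_nonneg {x : ℝ} (hx : 0 ≤ x) : M.U x = x ^ M.α := by simp [U, hx]

lemma U_of_nonpos {x : ℝ} (hx : x ≤ 0) : M.U x = -M.k * (-x) ^ M.α := by
  rcases hx.eq_or_lt with rfl | hx
  · simp [U, Real.zero_rpow M.α_pos.ne']
  · simp [U, not_le.2 hx, abs_of_neg hx]

lemma U_le {y : ℝ} (hy : 0 ≤ y) : M.U (y - M.γ) ≤ y ^ M.α := by
  have hγ := M.γ_pos
  rcases le_total 0 (y - M.γ) with h | h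
  · rw [M.U_of_nonneg h]
    exact Real.rpow_le_rpow h (by linarith) M.α_pos.le
  · rw [M.U_of_nonpos h]
    have h1 := Real.rpow_nonneg (neg_nonneg.2 h) M.α
    have h2 := Real.rpow_nonneg hy M.α
    nlinarith [M.k_nonneg]

lemma le_U {y : ℝ} (hy : 0 ≤ y) : -M.k * M.γ ^ M.α ≤ M.U (y - M.γ) := by
  have hγ := M.γ_pos
  have hk := M.k_nonneg
  rcases le_total 0 (y - M.γ) with h | h
  · rw [M.U_of_nonneg h]
    have h1 := Real.rpow_nonneg h M.α
    have h2 := Real.rpow_nonneg hγ.le M.α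
    nlinarith
  · rw [M.U_of_nonpos h]
    have : (-(y - M.γ)) ^ M.α ≤ M.γ ^ M.α :=
      Real.rpow_le_rpow (by linarith) (by linarith) M.α_pos.le
    nlinarith

lemma F_zero (θ : ℝ) : M.F 0 θ = -M.k * M.γ ^ M.α := by
  have hγ := M.γ_pos
  rw [F, M.U_of_nonpos (by linarith), Real.zero_rpow M.α_pos.ne']
  simp

lemma F_le {y : ℝ} (hy : 0 ≤ y) (θ : ℝ) : M.F y θ ≤ (1 + θ) * y ^ M.α := by
  have := M.U_le hy
  unfold F
  linarith

lemma F_add (y θ η : ℝ) : M.F y (θ + η) = M.F y θ + η * y ^ M.α := by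
  unfold F
  ring

/-! ### Demand at a given price -/

/-- The maximizers of `y ↦ F(y; θ) - p y` over `y ≥ 0`. -/
def demandSet (p θ : ℝ) : Set ℝ :=
  {y | 0 ≤ y ∧ ∀ y', 0 ≤ y' → M.F y' θ - p * y' ≤ M.F y θ - p * y}

/-- The least maximizer of `y ↦ F(y; θ) - p y` over `y ≥ 0`. -/
noncomputable def demand (p θ : ℝ) : ℝ := sInf (M.demandSet p θ)

/-- The gain of `y` over `0` is at most a multiple of `y ^ α` plus a constant, which the linear cost
eventually outweighs. The two summands are the bounds for `y ≤ 1` and for `y ≥ 1`; both are powers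
of the price, so they stay integrable at the price `c Z_τ`. -/
lemma le_of_F_zero_le {p θ T y : ℝ} (hp : 0 < p) (hT : θ ≤ T) (hT0 : 0 ≤ T) (hy : 0 ≤ y)
    (h : M.F 0 θ ≤ M.F y θ - p * y) :
    y ≤ (1 + T + M.k * M.γ ^ M.α) / p +
      ((1 + T + M.k * M.γ ^ M.α) / p) ^ (1 / (1 - M.α)) := by
  have hα := M.α_pos
  have hα1 := M.α_lt_one
  have hkγ : 0 ≤ M.k * M.γ ^ M.α := mul_nonneg M.k_nonneg (Real.rpow_nonneg M.γ_pos.le _)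
  set A := 1 + T + M.k * M.γ ^ M.α with hA
  have hA0 : 0 ≤ A / p := by positivity
  have h1 := M.F_le hy θ
  rw [F_zero] at h
  have hyα := Real.rpow_nonneg hy M.α
  have h2 : p * y ≤ (1 + T) * y ^ M.α + M.k * M.γ ^ M.α := by nlinarith
  rcases le_total y 1 with hy1 | hy1
  · have h3 : y ^ M.α ≤ 1 := Real.rpow_le_one hy hy1 hα.le
    have h4 : y ≤ A / p := by
      rw [le_div_iff₀ hp]
      nlinarith
    have := Real.rpow_nonneg hA0 (1 / (1 - M.α))
    linarith
  · have h3 : 1 ≤ y ^ M.α := Real.one_le_rpow hy1 hα.le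
    have h4 : p * y ≤ A * y ^ M.α := by nlinarith
    have hy0 : 0 < y := by linarith
    have h5 : y ^ (1 - M.α) ≤ A / p := by
      rw [Real.rpow_sub hy0, Real.rpow_one, div_le_div_iff₀ (by positivity) hp]
      linarith
    have h6 : y ≤ (A / p) ^ (1 / (1 - M.α)) := by
      calc y = (y ^ (1 - M.α)) ^ (1 / (1 - M.α)) := by
            rw [← Real.rpow_mul hy, mul_one_div_cancel (by linarith), Real.rpow_one]
        _ ≤ _ := Real.rpow_le_rpow (by positivity) h5 (by
            apply one_div_nonneg.2; linarith)
    linarith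

lemma le_of_mem_demandSet {p θ T y : ℝ} (hp : 0 < p) (hT : θ ≤ T) (hT0 : 0 ≤ T)
    (h : y ∈ M.demandSet p θ) :
    y ≤ (1 + T + M.k * M.γ ^ M.α) / p +
      ((1 + T + M.k * M.γ ^ M.α) / p) ^ (1 / (1 - M.α)) :=
  M.le_of_F_zero_le hp hT hT0 h.1 (by simpa using h.2 0 le_rfl)

lemma demandSet_nonempty {p : ℝ} (hp : 0 < p) (θ : ℝ) : (M.demandSet p θ).Nonempty := by
  set R := (1 + |θ| + M.k * M.γ ^ M.α) / p +
      ((1 + |θ| + M.k * M.γ ^ M.α) / p) ^ (1 / (1 - M.α)) with hR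
  have hkγ : 0 ≤ M.k * M.γ ^ M.α := mul_nonneg M.k_nonneg (Real.rpow_nonneg M.γ_pos.le _)
  have hR0 : 0 ≤ R := by positivity
  have hc : Continuous fun y => M.F y θ - p * y := by
    have := M.F_continuous.comp (continuous_id.prodMk (continuous_const (y := θ)))
    exact this.sub (continuous_const.mul continuous_id)
  obtain ⟨y, hy, hmax⟩ := isCompact_Icc.exists_isMaxOn (nonempty_Icc.2 hR0) hc.continuousOn
  refine ⟨y, hy.1, fun y' hy' => ?_⟩
  by_cases h : y' ≤ R
  · exact hmax ⟨hy', h⟩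
  · have h0 : M.F 0 θ - p * 0 ≤ M.F y θ - p * y := hmax ⟨le_rfl, hR0⟩
    by_contra! hlt
    exact h (M.le_of_F_zero_le hp (le_abs_self θ) (abs_nonneg θ) hy' (by linarith))

lemma mem_demandSet_of_tendsto {ι : Type*} {l : Filter ι} [l.NeBot] {p θ y : ι → ℝ}
    {p₀ θ₀ y₀ : ℝ} (hp : Tendsto p l (𝓝 p₀)) (hθ : Tendsto θ l (𝓝 θ₀)) (hy : Tendsto y l (𝓝 y₀))
    (h : ∀ᶠ i in l, y i ∈ M.demandSet (p i) (θ i)) : y₀ ∈ M.demandSet p₀ θ₀ := by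
  have hF : ∀ {z : ι → ℝ} {z₀ : ℝ}, Tendsto z l (𝓝 z₀) →
      Tendsto (fun i => M.F (z i) (θ i) - p i * z i) l (𝓝 (M.F z₀ θ₀ - p₀ * z₀)) := fun hz =>
    ((M.F_continuous.tendsto (_, _)).comp (hz.prodMk_nhds hθ)).sub (hp.mul hz)
  refine ⟨ge_of_tendsto hy (h.mono fun i hi => hi.1), fun y' hy' => ?_⟩
  exact le_of_tendsto_of_tendsto (hF tendsto_const_nhds) (hF hy) (h.mono fun i hi => hi.2 y' hy')

lemma isClosed_demandSet (p θ : ℝ) : IsClosed (M.demandSet p θ) := by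
  refine isClosed_of_closure_subset fun y hy => ?_
  obtain ⟨u, hu, hlim⟩ := mem_closure_iff_seq_limit.1 hy
  exact M.mem_demandSet_of_tendsto tendsto_const_nhds tendsto_const_nhds hlim
    (Eventually.of_forall hu)

lemma demandSet_bddBelow (p θ : ℝ) : BddBelow (M.demandSet p θ) := ⟨0, fun _ hy => hy.1⟩

lemma demand_mem {p : ℝ} (hp : 0 < p) (θ : ℝ) : M.demand p θ ∈ M.demandSet p θ :=
  (M.isClosed_demandSet p θ).csInf_mem (M.demandSet_nonempty hp θ) (M.demandSet_bddBelow p θ)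

lemma demandSet_antitone {p p' θ y y' : ℝ} (hp : p < p') (hy : y ∈ M.demandSet p θ)
    (hy' : y' ∈ M.demandSet p' θ) : y' ≤ y := by
  have h1 := hy.2 y' hy'.1
  have h2 := hy'.2 y hy.1
  nlinarith

lemma demand_antitone (θ : ℝ) {p p' : ℝ} (hp : 0 < p) (h : p ≤ p') :
    M.demand p' θ ≤ M.demand p θ := by
  rcases h.eq_or_lt with rfl | h
  · rfl
  · exact M.demandSet_antitone h (M.demand_mem hp θ) (M.demand_mem (hp.trans h) θ)

lemma antitone_demand_exp (θ : ℝ) : Antitone fun x => M.demand (Real.exp x) θ := fun _ _ h =>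
  M.demand_antitone θ (Real.exp_pos _) (Real.exp_le_exp.2 h)

/-- Demand just below a price dominates every maximizer at that price, so a second maximizer forces
a jump of the monotone demand, and there are countably many jumps. The logarithmic scale turns
demand into a monotone function on all of `ℝ`. -/
lemma countable_not_subsingleton (θ : ℝ) :
    {x | ¬ (M.demandSet (Real.exp x) θ).Subsingleton}.Countable := by
  refine Countable.mono (fun x hx => ?_) (M.antitone_demand_exp θ).countable_not_continuousAt
  rw [mem_ofPred_eq]
  intro hc
  refine hx ?_
  have key : ∀ y ∈ M.demandSet (Real.exp x) θ, y = M.demand (Real.exp x) θ := by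
    intro y hy
    refine le_antisymm ?_ (csInf_le (M.demandSet_bddBelow _ _) hy)
    have hc' : Tendsto (fun x => M.demand (Real.exp x) θ) (𝓝[<] x) (𝓝 (M.demand (Real.exp x) θ)) :=
      hc.tendsto.mono_left nhdsWithin_le_nhds
    refine ge_of_tendsto hc' ?_
    filter_upwards [self_mem_nhdsWithin] with x' hx'
    exact M.demandSet_antitone (Real.exp_lt_exp.2 hx') (M.demand_mem (Real.exp_pos _) θ) hy
  intro a ha b hb
  rw [key a ha, key b hb]

/-- Bounded maximizers converge to the maximizer of the limit problem if that is unique. -/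
lemma tendsto_of_subsingleton {ι : Type*} {l : Filter ι} {p θ y : ι → ℝ} {p₀ θ₀ y₀ C : ℝ}
    (hp : Tendsto p l (𝓝 p₀)) (hθ : Tendsto θ l (𝓝 θ₀))
    (h : ∀ᶠ i in l, y i ∈ M.demandSet (p i) (θ i)) (hC : ∀ᶠ i in l, y i ≤ C)
    (huniq : ∀ z ∈ M.demandSet p₀ θ₀, z = y₀) : Tendsto y l (𝓝 y₀) := by
  refine isCompact_Icc.tendsto_nhds_of_unique_mapClusterPt (s := Icc 0 C) ?_ fun z hz hclus => ?_
  · filter_upwards [h, hC] with i h1 h2 using ⟨h1.1, h2⟩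
  · apply huniq
    obtain ⟨g, hg, hyg⟩ := mapClusterPt_iff_ultrafilter.1 hclus
    have hne : (g : Filter ι).NeBot := g.neBot
    exact M.mem_demandSet_of_tendsto (hp.mono_left hg) (hθ.mono_left hg) hyg (hg h)

/-! ### The free good -/

lemma add_rpow_le {x : ℝ} (hx : 0 < x) {y : ℝ} (hy : 0 ≤ y) :
    (x + y) ^ M.α ≤ x ^ M.α + y * x ^ (M.α - 1) := by
  have h : (1 + y / x) ^ M.α ≤ 1 + y / x :=
    (Real.rpow_le_rpow_of_exponent_le (by
      have : 0 ≤ y / x := by positivity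
      linarith) M.α_lt_one.le).trans_eq (Real.rpow_one _)
  calc (x + y) ^ M.α = x ^ M.α * (1 + y / x) ^ M.α := by
        rw [← Real.mul_rpow hx.le (by positivity)]
        congr 1
        field_simp
    _ ≤ x ^ M.α * (1 + y / x) := by gcongr
    _ = _ := by
        rw [Real.rpow_sub hx, Real.rpow_one]
        field_simp

lemma exists_rpow_sub_one_eq {c : ℝ} (hc : 0 < c) : ∃ x, 0 < x ∧ x ^ (M.α - 1) = c := by
  have := M.α_lt_one
  refine ⟨c ^ (1 / (M.α - 1)), by positivity, ?_⟩
  rw [← Real.rpow_mul hc.le, one_div_mul_cancel (by linarith), Real.rpow_one]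

lemma gamma_lt_of_mem_demandSet_zero_of_nonneg {θ y : ℝ} (hθ : 0 ≤ θ)
    (h : y ∈ M.demandSet 0 θ) : M.γ < y := by
  by_contra! hy
  have hγ := M.γ_pos
  have h1 := h.2 (M.γ + 1) (by linarith)
  simp only [F, zero_mul, sub_zero] at h1
  rw [M.U_of_nonpos (by linarith : y - M.γ ≤ 0), M.U_of_nonneg (by linarith)] at h1
  have h2 : y ^ M.α ≤ (M.γ + 1) ^ M.α := Real.rpow_le_rpow h.1 (by linarith) M.α_pos.le
  have h3 : 0 ≤ (-(y - M.γ)) ^ M.α := Real.rpow_nonneg (by linarith) _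
  have h4 : (M.γ + 1 - M.γ) ^ M.α = 1 := by simp
  nlinarith [M.k_nonneg]

lemma gamma_lt_of_mem_demandSet_zero {θ y : ℝ} (hy : 0 < y) (h : y ∈ M.demandSet 0 θ) :
    M.γ < y := by
  rcases le_or_gt 0 θ with hθ | hθ
  · exact M.gamma_lt_of_mem_demandSet_zero_of_nonneg hθ h
  have hγ := M.γ_pos
  have hα := M.α_pos
  have hα1 := M.α_lt_one
  have hk := M.k_nonneg
  by_contra! hle
  rcases hle.eq_or_lt with rfl | hlt
  · -- the slope of the utility at the benchmark is infinite
    obtain ⟨ε, hε, hε'⟩ := M.exists_rpow_sub_one_eq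
      (c := -θ * M.γ ^ (M.α - 1) + 1) (by
        have := Real.rpow_pos_of_pos hγ (M.α - 1)
        nlinarith)
    have h1 := h.2 (M.γ + ε) (by linarith)
    simp only [F, zero_mul, sub_zero] at h1
    rw [M.U_of_nonneg (by linarith), M.U_of_nonneg (by linarith), sub_self,
      Real.zero_rpow hα.ne', add_sub_cancel_left] at h1
    have h2 := M.add_rpow_le hγ hε.le
    have h3 : ε ^ M.α = ε * ε ^ (M.α - 1) := by
      rw [Real.rpow_sub hε, Real.rpow_one]
      field_simp
    rw [h3, hε'] at h1
    nlinarith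
  -- For `θ < 0` the function `F(·; θ)` is strictly convex on `[0, γ]`, so its value at `y = t γ` is
  -- strictly below the chord. Comparison with both endpoints is contradictory.
  · set t := y / M.γ with ht
    have ht0 : 0 < t := by positivity
    have ht1 : t < 1 := (div_lt_one hγ).2 hlt
    have hyt : y = t * M.γ := by rw [ht]; field_simp
    have h0 := h.2 0 le_rfl
    have h1 := h.2 M.γ hγ.le
    rw [F_zero] at h0
    simp only [F, zero_mul, sub_zero] at h0 h1
    rw [M.U_of_nonpos (by linarith : y - M.γ ≤ 0)] at h0 h1
    rw [M.U_of_nonneg (by linarith), sub_self, Real.zero_rpow hα.ne'] at h1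
    have e1 : y ^ M.α = t ^ M.α * M.γ ^ M.α := by rw [hyt, Real.mul_rpow ht0.le hγ.le]
    have e2 : (-(y - M.γ)) ^ M.α = (1 - t) ^ M.α * M.γ ^ M.α := by
      rw [← Real.mul_rpow (by linarith) hγ.le, hyt]
      ring_nf
    have i1 : t < t ^ M.α := by
      simpa using Real.rpow_lt_rpow_of_exponent_gt ht0 ht1 hα1
    have i2 : 1 - t ≤ (1 - t) ^ M.α := by
      simpa using Real.rpow_le_rpow_of_exponent_ge (by linarith : 0 < 1 - t) (by linarith) hα1.le
    rw [e1, e2] at h0 h1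
    have hγα := Real.rpow_pos_of_pos hγ M.α
    set g := M.γ ^ M.α
    have j1 : M.k * (1 - t) * g ≤ M.k * ((1 - t) ^ M.α * g) := by
      rw [mul_assoc]; gcongr
    have j2 : θ * (t ^ M.α * g) < θ * (t * g) := by
      apply mul_lt_mul_of_neg_left _ hθ
      gcongr
    nlinarith

lemma hasDerivAt_F {y : ℝ} (hy : M.γ < y) (θ : ℝ) :
    HasDerivAt (fun y => M.F y θ) (M.α * ((y - M.γ) ^ (M.α - 1) + θ * y ^ (M.α - 1))) y := by
  have hγ := M.γ_pos
  have h1 : HasDerivAt (fun y => (y - M.γ) ^ M.α) (1 * M.α * (y - M.γ) ^ (M.α - 1)) y :=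
    ((hasDerivAt_id y).sub_const M.γ).rpow_const (Or.inl (by simp; linarith))
  have h2 : HasDerivAt (fun y : ℝ => y ^ M.α) (1 * M.α * y ^ (M.α - 1)) y :=
    (hasDerivAt_id y).rpow_const (Or.inl (by simp; linarith))
  have h3 := h1.add (h2.const_mul θ)
  have h4 : (fun y => M.F y θ) =ᶠ[𝓝 y] (fun y => (y - M.γ) ^ M.α) + fun y => θ * y ^ M.α := by
    filter_upwards [lt_mem_nhds hy] with z hz
    simp [F, M.U_of_nonneg (by linarith : 0 ≤ z - M.γ)]
  refine (h3.congr_of_eventuallyEq h4).congr_deriv ?_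
  ring

lemma rpow_eq_of_mem_demandSet_zero {θ y : ℝ} (hy : 0 < y) (h : y ∈ M.demandSet 0 θ) :
    (y - M.γ) ^ (M.α - 1) = -θ * y ^ (M.α - 1) := by
  have hγ := M.gamma_lt_of_mem_demandSet_zero hy h
  have hmax : IsLocalMax (fun y => M.F y θ) y := by
    filter_upwards [lt_mem_nhds hy] with z hz
    simpa using h.2 z hz.le
  have := hmax.hasDerivAt_eq_zero (M.hasDerivAt_F hγ θ)
  have h2 := (mul_eq_zero.1 this).resolve_left M.α_pos.ne'
  linarith

/-- The first-order condition reads `(1 - γ / y) ^ (α - 1) = -θ`, and its left side is injective in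
`y`. -/
lemma eq_of_mem_demandSet_zero {θ y y' : ℝ} (hy : 0 < y) (h : y ∈ M.demandSet 0 θ)
    (hy' : 0 < y') (h' : y' ∈ M.demandSet 0 θ) : y = y' := by
  have hγ := M.γ_pos
  have key : ∀ z, 0 < z → z ∈ M.demandSet 0 θ →
      0 < 1 - M.γ / z ∧ (1 - M.γ / z) ^ (M.α - 1) = -θ := by
    intro z hz hmem
    have h1 := M.gamma_lt_of_mem_demandSet_zero hz hmem
    have h2 := M.rpow_eq_of_mem_demandSet_zero hz hmem
    have e : 1 - M.γ / z = (z - M.γ) / z := by field_simp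
    rw [e, Real.div_rpow (by linarith) hz.le, h2]
    refine ⟨div_pos (by linarith) hz, ?_⟩
    have := Real.rpow_pos_of_pos hz (M.α - 1)
    field_simp
  obtain ⟨a1, b1⟩ := key y hy h
  obtain ⟨a2, b2⟩ := key y' hy' h'
  have h3 := (Real.rpow_left_inj a1.le a2.le (by linarith [M.α_lt_one])).1 (b1.trans b2.symm)
  have h4 : M.γ / y = M.γ / y' := by linarith
  field_simp at h4
  exact h4.symm

/-- At a positive maximizer, `-θ = (1 - γ / y) ^ (α - 1) > 1`. If `0` is a maximizer, its value `-k
γ ^ α` is beaten by large arguments when `θ ≥ -1`, because `(y - γ) ^ α - y ^ α` tends to `0`. -/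
lemma lt_neg_one_of_mem_demandSet_zero {θ y : ℝ} (hθ : 0 ≤ θ ∨ 0 < M.k)
    (h : y ∈ M.demandSet 0 θ) : θ < -1 := by
  by_contra! hge
  have hγ := M.γ_pos
  have hα1 := M.α_lt_one
  rcases h.1.eq_or_lt with h0 | hy
  · subst h0
    rcases hθ with hθ | hk
    · exact absurd (M.gamma_lt_of_mem_demandSet_zero_of_nonneg hθ h) (by linarith)
    · have hγα := Real.rpow_pos_of_pos hγ M.α
      obtain ⟨x, hx, hx'⟩ := M.exists_rpow_sub_one_eq
        (c := M.k * M.γ ^ M.α / (2 * M.γ)) (by positivity)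
      have h1 := h.2 (x + M.γ) (by linarith)
      rw [F_zero] at h1
      simp only [F, zero_mul, sub_zero, mul_zero] at h1
      rw [add_sub_cancel_right, M.U_of_nonneg hx.le] at h1
      have h2 := M.add_rpow_le hx hγ.le
      have h3 : 0 ≤ (x + M.γ) ^ M.α := Real.rpow_nonneg (by linarith) _
      have h4 : M.γ * x ^ (M.α - 1) = M.k * M.γ ^ M.α / 2 := by
        rw [hx']; field_simp
      have h5 : 0 < M.k * M.γ ^ M.α := by positivity
      nlinarith
  · have h1 := M.gamma_lt_of_mem_demandSet_zero hy h
    have h2 := M.rpow_eq_of_mem_demandSet_zero hy h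
    have h3 : y ^ (M.α - 1) < (y - M.γ) ^ (M.α - 1) :=
      Real.rpow_lt_rpow_of_neg (by linarith) (by linarith) (by linarith)
    have h4 := Real.rpow_pos_of_pos hy (M.α - 1)
    nlinarith

lemma le_of_mem_demandSet_of_lt_neg_one {p θ θ' y : ℝ} (hp : 0 ≤ p) (hθ' : θ' < -1)
    (hθ : θ ≤ θ') (h : y ∈ M.demandSet p θ) :
    y ≤ (M.k * M.γ ^ M.α / (-1 - θ')) ^ (1 / M.α) := by
  have h0 := h.2 0 le_rfl
  have h1 := M.F_le h.1 θ
  have hα := M.α_pos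
  rw [F_zero] at h0
  have h2 := mul_nonneg hp h.1
  have h3 := Real.rpow_nonneg h.1 M.α
  have h4 : y ^ M.α ≤ M.k * M.γ ^ M.α / (-1 - θ') := by
    rw [le_div_iff₀ (by linarith)]
    nlinarith
  calc y = (y ^ M.α) ^ (1 / M.α) := by
        rw [← Real.rpow_mul h.1, mul_one_div_cancel hα.ne', Real.rpow_one]
    _ ≤ _ := Real.rpow_le_rpow h3 h4 (by positivity)

end Model

/-- The pricing kernel `Z_τ` of one evaluation period. -/
noncomputable def periodKernel {Ω : Type*} (M : Model) (B : ℝ≥0 → Ω → ℝ) : Ω → ℝ :=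
  pricingKernel M B M.τ.toNNReal

lemma periodKernel_pos {Ω : Type*} {M : Model} {B : ℝ≥0 → Ω → ℝ} (ω : Ω) :
    0 < periodKernel M B ω := Real.exp_pos _

/-! ### Measurability, moments and law of the pricing kernel -/

section PricingKernel

variable {Ω : Type*} [MeasurableSpace Ω] {P : Measure Ω} {B : ℝ≥0 → Ω → ℝ} {M : Model}

lemma measurable_of_isBrownianReal [P.IsComplete] (hB : IsBrownianReal B P) (t : ℝ≥0) :
    Measurable (B t) :=
  (hB.toIsPreBrownianReal.aemeasurable t).nullMeasurable.measurable_of_complete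

lemma augmentedSigma_le [P.IsComplete] (hB : IsBrownianReal B P) (t : ℝ≥0) :
    augmentedSigma P B t ≤ ‹MeasurableSpace Ω› := by
  have hle : (⨆ s : Iic t, MeasurableSpace.comap (fun ω => B s ω - B 0 ω) inferInstance) ≤
      ‹MeasurableSpace Ω› := iSup_le fun s =>
    ((measurable_of_isBrownianReal hB s).sub (measurable_of_isBrownianReal hB 0)).comap_le
  rintro s ⟨u, hu, hsu⟩
  exact ((hle u hu).nullMeasurableSet.congr hsu.symm).measurable_of_complete

lemma measurable_augmentedSigma_eval (hB : IsBrownianReal B P) (t : ℝ≥0) :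
    Measurable[augmentedSigma P B t] (B t) := by
  have h : Measurable[⨆ s : Iic t,
      MeasurableSpace.comap (fun ω => B s ω - B 0 ω) inferInstance] (fun ω => B t ω - B 0 ω) :=
    measurable_iff_comap_le.2 (le_iSup (fun s : Iic t =>
      MeasurableSpace.comap (fun ω => B s ω - B 0 ω) inferInstance) ⟨t, le_refl t⟩)
  -- The filtration is generated by the increments from time `0`; since `B 0 = 0` almost surely, the
  -- null sets give measurability of `B t` itself.
  refine EventuallyMeasurable.congr (l := ae P) (h.eventuallyMeasurable) ?_
  filter_upwards [hB.toIsPreBrownianReal.eval_zero_ae_eq_zero] with ω hω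
  rw [hω, sub_zero]

lemma measurable_augmentedSigma_periodKernel (hB : IsBrownianReal B P) :
    Measurable[augmentedSigma P B M.τ.toNNReal] (periodKernel M B) := by
  have h := measurable_augmentedSigma_eval hB M.τ.toNNReal
  have hg : Measurable fun x : ℝ =>
      Real.exp (-M.sharpe * x - (M.r + M.sharpe ^ 2 / 2) * (M.τ.toNNReal : ℝ)) := by fun_prop
  exact hg.comp h

lemma measurable_periodKernel [P.IsComplete] (hB : IsBrownianReal B P) :
    Measurable (periodKernel M B) :=
  (measurable_augmentedSigma_periodKernel hB).mono (augmentedSigma_le hB _) le_rfl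

omit [MeasurableSpace Ω] in
lemma periodKernel_rpow (q : ℝ) (ω : Ω) :
    periodKernel M B ω ^ q = Real.exp (-(q * M.sharpe) * B M.τ.toNNReal ω) *
      Real.exp (-(q * (M.r + M.sharpe ^ 2 / 2) * M.τ)) := by
  rw [periodKernel, pricingKernel, ← Real.exp_mul, ← Real.exp_add, Real.coe_toNNReal _ M.τ_pos.le]
  ring_nf

lemma integrable_exp_mul_eval (hB : IsBrownianReal B P) (t : ℝ≥0) (a : ℝ) :
    Integrable (fun ω => Real.exp (a * B t ω)) P := by
  have h := hB.toIsPreBrownianReal.hasLaw_eval t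
  have h2 : Integrable (fun x => Real.exp (a * x)) (P.map (B t)) := by
    rw [h.map_eq]
    exact integrable_exp_mul_gaussianReal a
  exact h2.comp_aemeasurable h.aemeasurable

lemma integrable_periodKernel_rpow (hB : IsBrownianReal B P) (q : ℝ) :
    Integrable (fun ω => periodKernel M B ω ^ q) P := by
  simp_rw [periodKernel_rpow]
  exact (integrable_exp_mul_eval hB _ _).mul_const _

lemma integrable_periodKernel (hB : IsBrownianReal B P) : Integrable (periodKernel M B) P := by
  simpa using integrable_periodKernel_rpow (M := M) hB 1

lemma integral_periodKernel_rpow (hB : IsBrownianReal B P) :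
    ∫ ω, periodKernel M B ω ^ (-(M.α / (1 - M.α))) ∂P =
      Real.exp (M.h * M.τ / (1 - M.α)) := by
  simp_rw [periodKernel_rpow]
  rw [integral_mul_const]
  have h := mgf_gaussianReal (hB.toIsPreBrownianReal.hasLaw_eval M.τ.toNNReal).map_eq
    (-(-(M.α / (1 - M.α)) * M.sharpe))
  rw [mgf] at h
  rw [h, ← Real.exp_add, Real.coe_toNNReal _ M.τ_pos.le, Model.h]
  have : 1 - M.α ≠ 0 := by linarith [M.α_lt_one]
  congr 1
  field_simp
  ring

/-- The law of the pricing kernel has no atoms. -/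
lemma ae_log_periodKernel_notMem (hB : IsBrownianReal B P) {S : Set ℝ} (hS : S.Countable)
    {c : ℝ} (hc : 0 < c) : ∀ᵐ ω ∂P, Real.log (c * periodKernel M B ω) ∉ S := by
  have hlaw := hB.toIsPreBrownianReal.hasLaw_eval M.τ.toNNReal
  have hτ : M.τ.toNNReal ≠ 0 := by simpa using M.τ_pos
  have := nullSingletonClass_gaussianReal (μ := 0) hτ
  set g : ℝ → ℝ := fun x => Real.log c + (-M.sharpe * x - (M.r + M.sharpe ^ 2 / 2) * M.τ.toNNReal)
  have hinj : Function.Injective g := by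
    intro x y hxy
    have h1 : M.sharpe * x = M.sharpe * y := by simp only [g] at hxy; linarith
    exact mul_left_cancel₀ M.sharpe_ne_zero h1
  have hT : (g ⁻¹' S).Countable := hS.preimage_of_injOn hinj.injOn
  have h0 : ∀ᵐ x ∂(P.map (B M.τ.toNNReal)), x ∉ g ⁻¹' S := by
    rw [hlaw.map_eq]
    exact measure_eq_zero_iff_ae_notMem.1 (hT.measure_zero _)
  filter_upwards [ae_of_ae_map hlaw.aemeasurable h0] with ω hω
  rw [Real.log_mul hc.ne' (periodKernel_pos ω).ne', periodKernel, pricingKernel, Real.log_exp]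
  exact hω

lemma ae_periodKernel_ne (hB : IsBrownianReal B P) (z : ℝ) :
    ∀ᵐ ω ∂P, periodKernel M B ω ≠ z := by
  filter_upwards [ae_log_periodKernel_notMem (M := M) hB
    (countable_singleton (Real.log z)) one_pos]
    with ω hω h
  exact hω (by rw [one_mul, h]; rfl)

/-! ### Attainable returns -/

variable [IsProbabilityMeasure P] [P.IsComplete] {Y : Ω → ℝ}

omit [IsProbabilityMeasure P] [P.IsComplete] in
lemma mem_returns_of_integral_le
    (hm : Measurable[augmentedSigma P B M.τ.toNNReal] Y)
    (h0 : ∀ ω, 0 ≤ Y ω) (hint : Integrable (fun ω => periodKernel M B ω * Y ω) P)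
    (hle : ∫ ω, periodKernel M B ω * Y ω ∂P ≤ 1) : Y ∈ returns M P B := by
  refine ⟨hm, Eventually.of_forall h0, ?_⟩
  have := ofReal_integral_eq_lintegral_ofReal hint
    (Eventually.of_forall fun ω => mul_nonneg (periodKernel_pos ω).le (h0 ω))
  rw [periodKernel] at this
  rw [← this]
  exact ENNReal.ofReal_le_one.2 hle

omit [IsProbabilityMeasure P] in
lemma measurable_of_mem_returns (hB : IsBrownianReal B P) (hY : Y ∈ returns M P B) :
    Measurable Y := hY.1.mono (augmentedSigma_le hB _) le_rfl

omit [IsProbabilityMeasure P] in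
lemma integrable_mul_of_mem_returns (hB : IsBrownianReal B P) (hY : Y ∈ returns M P B) :
    Integrable (fun ω => periodKernel M B ω * Y ω) P := by
  refine (lintegral_ofReal_ne_top_iff_integrable ?_ ?_).1 (hY.2.2.trans_lt ENNReal.one_lt_top).ne
  · exact ((measurable_periodKernel hB).mul
      (measurable_of_mem_returns hB hY)).aestronglyMeasurable
  · filter_upwards [hY.2.1] with ω hω using mul_nonneg (periodKernel_pos ω).le hω

omit [IsProbabilityMeasure P] in
lemma integral_mul_le_of_mem_returns (hB : IsBrownianReal B P) (hY : Y ∈ returns M P B) :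
    ∫ ω, periodKernel M B ω * Y ω ∂P ≤ 1 := by
  have := ofReal_integral_eq_lintegral_ofReal (integrable_mul_of_mem_returns hB hY) (by
    filter_upwards [hY.2.1] with ω hω using mul_nonneg (periodKernel_pos ω).le hω)
  rw [← ENNReal.ofReal_le_one, this]
  exact hY.2.2

omit [IsProbabilityMeasure P] in
-- Hölder's inequality with weights `α` and `1 - α` for `Y ^ α = (Z Y) ^ α (Z ^ (-α / (1 - α))) ^ (1
-- - α)`: the first factor is controlled by the budget, the second is a Gaussian exponential moment.
lemma lintegral_rpow_le (hB : IsBrownianReal B P) (hY : Y ∈ returns M P B) :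
    ∫⁻ ω, ENNReal.ofReal (Y ω ^ M.α) ∂P ≤ ENNReal.ofReal (Real.exp (M.h * M.τ)) := by
  have hα := M.α_pos
  have hα1 : 0 < 1 - M.α := by linarith [M.α_lt_one]
  set Z := periodKernel M B
  have hZ := measurable_periodKernel (M := M) hB
  have hYm := measurable_of_mem_returns hB hY
  have h := ENNReal.lintegral_mul_norm_pow_le (μ := P)
    (f := fun ω => ENNReal.ofReal (Z ω * Y ω))
    (g := fun ω => ENNReal.ofReal (Z ω ^ (-(M.α / (1 - M.α)))))
    (hZ.mul hYm).ennreal_ofReal.aemeasurable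
    (hZ.pow_const _).ennreal_ofReal.aemeasurable hα.le hα1.le (by ring)
  have e1 : ∫⁻ ω, ENNReal.ofReal (Z ω * Y ω) ^ M.α *
      ENNReal.ofReal (Z ω ^ (-(M.α / (1 - M.α)))) ^ (1 - M.α) ∂P =
      ∫⁻ ω, ENNReal.ofReal (Y ω ^ M.α) ∂P := by
    refine lintegral_congr_ae ?_
    filter_upwards [hY.2.1] with ω hω
    have hz : 0 < Z ω := periodKernel_pos ω
    rw [ENNReal.ofReal_rpow_of_nonneg (mul_nonneg hz.le hω) hα.le,
      ENNReal.ofReal_rpow_of_nonneg (Real.rpow_nonneg hz.le _) hα1.le,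
      ← ENNReal.ofReal_mul (Real.rpow_nonneg (mul_nonneg hz.le hω) _),
      Real.mul_rpow hz.le hω, ← Real.rpow_mul hz.le, neg_mul, div_mul_cancel₀ _ hα1.ne',
      mul_right_comm, ← Real.rpow_add hz, add_neg_cancel, Real.rpow_zero, one_mul]
  have e2 : ∫⁻ ω, ENNReal.ofReal (Z ω ^ (-(M.α / (1 - M.α)))) ∂P =
      ENNReal.ofReal (Real.exp (M.h * M.τ / (1 - M.α))) := by
    rw [← integral_periodKernel_rpow hB, ofReal_integral_eq_lintegral_ofReal
      (integrable_periodKernel_rpow hB _)]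
    exact Eventually.of_forall fun ω => Real.rpow_nonneg (periodKernel_pos ω).le _
  rw [e1, e2, ENNReal.ofReal_rpow_of_nonneg (Real.exp_pos _).le hα1.le, ← Real.exp_mul,
    div_mul_cancel₀ _ hα1.ne'] at h
  refine h.trans ?_
  calc _ ≤ (1 : ℝ≥0∞) ^ M.α * ENNReal.ofReal (Real.exp (M.h * M.τ)) := by
        gcongr
        exact hY.2.2
    _ = _ := by simp

omit [IsProbabilityMeasure P] in
lemma integrable_rpow_of_mem_returns (hB : IsBrownianReal B P) (hY : Y ∈ returns M P B) :
    Integrable (fun ω => Y ω ^ M.α) P := by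
  refine (lintegral_ofReal_ne_top_iff_integrable ?_ ?_).1
    ((lintegral_rpow_le hB hY).trans_lt ENNReal.ofReal_lt_top).ne
  · exact ((measurable_of_mem_returns hB hY).pow_const _).aestronglyMeasurable
  · filter_upwards [hY.2.1] with ω hω using Real.rpow_nonneg hω _

omit [IsProbabilityMeasure P] [P.IsComplete] in
lemma integral_rpow_nonneg (hY : Y ∈ returns M P B) : 0 ≤ ∫ ω, Y ω ^ M.α ∂P := by
  refine integral_nonneg_of_ae ?_
  filter_upwards [hY.2.1] with ω hω using Real.rpow_nonneg hω _

omit [IsProbabilityMeasure P] in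
lemma integral_rpow_le (hB : IsBrownianReal B P) (hY : Y ∈ returns M P B) :
    ∫ ω, Y ω ^ M.α ∂P ≤ Real.exp (M.h * M.τ) := by
  have := ofReal_integral_eq_lintegral_ofReal (integrable_rpow_of_mem_returns hB hY) (by
    filter_upwards [hY.2.1] with ω hω using Real.rpow_nonneg hω _)
  rw [← ENNReal.ofReal_le_ofReal_iff (Real.exp_pos _).le, this]
  exact lintegral_rpow_le hB hY

/-! ### The value function `Φ` -/

omit [P.IsComplete] in
lemma integrable_F_of_integrable_rpow (hYm : Measurable Y) (h0 : ∀ᵐ ω ∂P, 0 ≤ Y ω)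
    (hint : Integrable (fun ω => Y ω ^ M.α) P) (θ : ℝ) :
    Integrable (fun ω => M.F (Y ω) θ) P := by
  refine Integrable.add ?_ (hint.const_mul θ)
  refine Integrable.mono' (hint.add (integrable_const (M.k * M.γ ^ M.α))) ?_ ?_
  · exact (M.U_continuous.measurable.comp (hYm.sub_const _)).aestronglyMeasurable
  · filter_upwards [h0] with ω hω
    have h1 := M.U_le hω
    have h2 := M.le_U hω
    have h3 := Real.rpow_nonneg hω M.α
    have h4 : 0 ≤ M.k * M.γ ^ M.α := mul_nonneg M.k_nonneg (Real.rpow_nonneg M.γ_pos.le _)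
    rw [Real.norm_eq_abs, abs_le]
    simp only [Pi.add_apply]
    constructor <;> linarith

lemma integrable_F_of_mem_returns (hB : IsBrownianReal B P) (hY : Y ∈ returns M P B) (θ : ℝ) :
    Integrable (fun ω => M.F (Y ω) θ) P :=
  integrable_F_of_integrable_rpow (measurable_of_mem_returns hB hY) hY.2.1
    (integrable_rpow_of_mem_returns hB hY) θ

lemma objective_add (hB : IsBrownianReal B P) (hY : Y ∈ returns M P B) (θ η : ℝ) :
    objective M P (θ + η) Y = objective M P θ Y + η * ∫ ω, Y ω ^ M.α ∂P := by
  unfold objective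
  simp_rw [M.F_add]
  rw [integral_add (integrable_F_of_mem_returns hB hY θ)
    ((integrable_rpow_of_mem_returns hB hY).const_mul η), integral_const_mul]

omit [P.IsComplete] in
lemma zero_mem_returns : (fun _ => 0) ∈ returns M P B :=
  ⟨measurable_const, by simp, by simp⟩

omit [P.IsComplete] in
lemma returns_nonempty : (returns M P B).Nonempty := ⟨_, zero_mem_returns⟩

lemma objective_zero_le (hB : IsBrownianReal B P) (hY : Y ∈ returns M P B) :
    objective M P 0 Y ≤ Real.exp (M.h * M.τ) := by
  refine le_trans (integral_mono_ae (integrable_F_of_mem_returns hB hY 0)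
    (integrable_rpow_of_mem_returns hB hY) ?_) (integral_rpow_le hB hY)
  filter_upwards [hY.2.1] with ω hω
  simpa using M.F_le hω 0

lemma bddAbove_objective (hB : IsBrownianReal B P) (θ : ℝ) :
    BddAbove (objective M P θ '' returns M P B) := by
  refine ⟨Real.exp (M.h * M.τ) + |θ| * Real.exp (M.h * M.τ), ?_⟩
  rintro _ ⟨Y, hY, rfl⟩
  have h := objective_add hB hY 0 θ
  rw [zero_add] at h
  have h1 := objective_zero_le hB hY
  have h2 := integral_rpow_nonneg hY
  have h3 := integral_rpow_le hB hY
  rw [h]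
  have : θ * ∫ ω, Y ω ^ M.α ∂P ≤ |θ| * Real.exp (M.h * M.τ) :=
    (mul_le_mul_of_nonneg_right (le_abs_self θ) h2).trans
      (mul_le_mul_of_nonneg_left h3 (abs_nonneg θ))
  linarith

lemma objective_le_Phi (hB : IsBrownianReal B P) (hY : Y ∈ returns M P B) (θ : ℝ) :
    objective M P θ Y ≤ Phi M P B θ :=
  le_csSup (bddAbove_objective hB θ) ⟨Y, hY, rfl⟩

omit [P.IsComplete] in
lemma Phi_le {θ C : ℝ} (h : ∀ Y ∈ returns M P B, objective M P θ Y ≤ C) : Phi M P B θ ≤ C := by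
  refine csSup_le (returns_nonempty.image _) ?_
  rintro _ ⟨Y, hY, rfl⟩
  exact h Y hY

lemma le_Phi (hB : IsBrownianReal B P) (θ : ℝ) : -M.k * M.γ ^ M.α ≤ Phi M P B θ := by
  refine le_trans (le_of_eq ?_) (objective_le_Phi hB zero_mem_returns θ)
  simp [objective, M.F_zero]

lemma Phi_mono (hB : IsBrownianReal B P) : Monotone (Phi M P B) := by
  intro a b hab
  refine Phi_le fun Y hY => ?_
  have h := objective_add hB hY a (b - a)
  rw [add_sub_cancel] at h
  have := mul_nonneg (sub_nonneg.2 hab) (integral_rpow_nonneg hY)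
  linarith [objective_le_Phi hB hY b]

lemma Phi_add_le (hB : IsBrownianReal B P) {a b : ℝ} (hab : a ≤ b) :
    Phi M P B b ≤ Phi M P B a + Real.exp (M.h * M.τ) * (b - a) := by
  refine Phi_le fun Y hY => ?_
  have h := objective_add hB hY a (b - a)
  rw [add_sub_cancel] at h
  have := mul_le_mul_of_nonneg_left (integral_rpow_le hB hY) (sub_nonneg.2 hab)
  linarith [objective_le_Phi hB hY a]

/-- `Φ` is a supremum of functions affine in `θ`. -/
lemma convexOn_Phi (hB : IsBrownianReal B P) : ConvexOn ℝ univ (Phi M P B) := by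
  refine ⟨convex_univ, fun a _ b _ s t hs ht hst => Phi_le fun Y hY => ?_⟩
  have h1 := objective_add hB hY (s • a + t • b) (a - (s • a + t • b))
  have h2 := objective_add hB hY (s • a + t • b) (b - (s • a + t • b))
  rw [add_sub_cancel] at h1 h2
  have h3 := mul_le_mul_of_nonneg_left (objective_le_Phi hB hY a) hs
  have h4 := mul_le_mul_of_nonneg_left (objective_le_Phi hB hY b) ht
  rw [h1] at h3
  rw [h2] at h4
  simp only [smul_eq_mul] at *
  obtain rfl : t = 1 - s := by linarith
  nlinarith

/-- A maximizer yields a subgradient of the value function. -/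
lemma subgradient_of_mem_maximizers (hB : IsBrownianReal B P) {θ : ℝ}
    (hY : Y ∈ maximizers M P B θ) (θ' : ℝ) :
    Phi M P B θ + (∫ ω, Y ω ^ M.α ∂P) * (θ' - θ) ≤ Phi M P B θ' := by
  have h := objective_add hB hY.1 θ (θ' - θ)
  rw [add_sub_cancel] at h
  have h1 : Phi M P B θ ≤ objective M P θ Y := Phi_le fun Y' hY' => hY.2 hY'
  linarith [objective_le_Phi hB hY.1 θ']

omit [IsProbabilityMeasure P] [P.IsComplete] in
lemma AMy_eq : AMy M P B = M.disc * Phi M P B 0 := by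
  have : objective M P 0 = fun Y : Ω → ℝ => ∫ ω, M.U (Y ω - M.γ) ∂P := by
    funext Y
    simp [objective, Model.F]
  rw [AMy, Phi, this]

end PricingKernel

/-! ### Subgradients of convex functions of one variable -/

/-- `ξ` is a subgradient of `f` at `θ`. -/
def IsSubgradient (f : ℝ → ℝ) (θ ξ : ℝ) : Prop := ∀ θ', f θ + ξ * (θ' - θ) ≤ f θ'

section Subgradient

variable {f : ℝ → ℝ} {H C ρ β : ℝ}

lemma IsSubgradient.mul_sub_nonneg {θ ξ θ' ξ' : ℝ} (h : IsSubgradient f θ ξ)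
    (h' : IsSubgradient f θ' ξ') : 0 ≤ (ξ - ξ') * (θ - θ') := by
  have h1 := h θ'
  have h2 := h' θ
  nlinarith

lemma IsSubgradient.nonneg {θ ξ : ℝ} (h : IsSubgradient f θ ξ) (hf : Monotone f) : 0 ≤ ξ := by
  have h1 := h (θ - 1)
  have h2 := hf (sub_le_self θ zero_le_one)
  linarith

lemma IsSubgradient.le {θ ξ : ℝ} (h : IsSubgradient f θ ξ)
    (hH : ∀ a b, a ≤ b → f b ≤ f a + H * (b - a)) : ξ ≤ H := by
  have h1 := h (θ + 1)
  have h2 := hH θ (θ + 1) (by linarith)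
  linarith

lemma lipschitzWith_of_monotone (hf : Monotone f) (hH0 : 0 ≤ H)
    (hH : ∀ a b, a ≤ b → f b ≤ f a + H * (b - a)) : LipschitzWith H.toNNReal f := by
  refine LipschitzWith.of_dist_le_mul fun a b => ?_
  rw [Real.coe_toNNReal _ hH0, Real.dist_eq, Real.dist_eq]
  wlog hab : a ≤ b generalizing a b
  · rw [abs_sub_comm, abs_sub_comm a]
    exact this b a (le_of_not_ge hab)
  · rw [abs_of_nonpos (by linarith [hf hab]), abs_of_nonpos (by linarith)]
    linarith [hH a b hab]

/-- Every real number is the sum of a point and of a subgradient at that point. -/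
lemma exists_isSubgradient_sub (hconv : ConvexOn ℝ univ f) (hcont : Continuous f)
    (hC : ∀ θ, -C ≤ f θ) (x : ℝ) : ∃ θ, IsSubgradient f θ (x - θ) := by
  -- Outside the ball of radius `R` the quadratic penalty alone exceeds `f x + C`, so the minimizer
  -- over the ball is global.
  set R := |f x + C| + 2 with hR
  have hR0 : 0 ≤ R := by positivity
  have hg : Continuous fun θ => f θ + (θ - x) ^ 2 / 2 := by fun_prop
  obtain ⟨θ, hθ, hmin⟩ := (isCompact_closedBall x R).exists_isMinOn
    ⟨x, Metric.mem_closedBall_self hR0⟩ hg.continuousOn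
  have hmin' : ∀ θ', f θ + (θ - x) ^ 2 / 2 ≤ f θ' + (θ' - x) ^ 2 / 2 := by
    intro θ'
    by_cases h : θ' ∈ Metric.closedBall x R
    · exact hmin h
    · have h1 : f θ + (θ - x) ^ 2 / 2 ≤ f x + (x - x) ^ 2 / 2 :=
        hmin (Metric.mem_closedBall_self hR0)
      rw [Metric.mem_closedBall, Real.dist_eq, not_le] at h
      have h2 : R ^ 2 ≤ (θ' - x) ^ 2 := by
        rw [← sq_abs (θ' - x)]
        gcongr
      have h3 := hC θ'
      have h4 := le_abs_self (f x + C)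
      nlinarith [abs_nonneg (f x + C)]
  refine ⟨θ, fun θ' => ?_⟩
  set d := θ' - θ with hd
  -- Minimality is tested along the segment towards `θ'`. After division by `t`, the quadratic error
  -- vanishes as `t → 0`.
  have key : ∀ t ∈ Ioo (0 : ℝ) 1, -(t * d ^ 2 / 2) ≤ f θ' - f θ - (x - θ) * d := by
    rintro t ⟨ht0, ht1⟩
    have h1 := hmin' (θ + t * d)
    have h2 := hconv.2 (mem_univ θ) (mem_univ θ') (by linarith : 0 ≤ 1 - t) ht0.le (by ring)
    have e : (1 - t) • θ + t • θ' = θ + t * d := by simp only [smul_eq_mul, hd]; ring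
    rw [e] at h2
    simp only [smul_eq_mul] at h2
    have h3 : 0 ≤ t * (f θ' - f θ - (x - θ) * d + t * d ^ 2 / 2) := by nlinarith
    have h4 := nonneg_of_mul_nonneg_right h3 ht0
    linarith
  have hlim : Tendsto (fun t : ℝ => -(t * d ^ 2 / 2)) (𝓝[>] 0) (𝓝 (-(0 * d ^ 2 / 2))) :=
    (Continuous.tendsto (by fun_prop) 0).mono_left nhdsWithin_le_nhds
  have := le_of_tendsto hlim (by
    filter_upwards [Ioo_mem_nhdsGT (zero_lt_one (α := ℝ))] with t ht using key t ht)
  linarith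

/-- A continuous parametrization of the graph of the subdifferential, by the sum of the two
coordinates. -/
lemma exists_continuous_parametrization (hconv : ConvexOn ℝ univ f) (hcont : Continuous f)
    (hC : ∀ θ, -C ≤ f θ) :
    ∃ θ : ℝ → ℝ, Continuous θ ∧ Monotone θ ∧ (∀ x, IsSubgradient f (θ x) (x - θ x)) ∧
      ∀ a ξ, IsSubgradient f a ξ → θ (a + ξ) = a := by
  choose θ hθ using exists_isSubgradient_sub hconv hcont hC
  -- Monotonicity of the subdifferential makes `θ` firmly nonexpansive; this yields both that it is
  -- `1`-Lipschitz and that it is monotone.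
  have key : ∀ x y, (θ x - θ y) ^ 2 ≤ (x - y) * (θ x - θ y) := fun x y => by
    have := (hθ x).mul_sub_nonneg (hθ y)
    nlinarith
  refine ⟨θ, ?_, fun x y hxy => ?_, hθ, fun a ξ h => ?_⟩
  · refine (LipschitzWith.of_dist_le_mul (K := 1) fun x y => ?_).continuous
    rw [NNReal.coe_one, one_mul, Real.dist_eq, Real.dist_eq]
    have h1 := key x y
    have h2 : |θ x - θ y| ^ 2 ≤ |x - y| * |θ x - θ y| := by
      rw [sq_abs, ← abs_mul]
      exact h1.trans (le_abs_self _)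
    by_contra! hlt
    nlinarith [abs_nonneg (x - y)]
  · have h1 := key y x
    by_contra! hlt
    nlinarith
  · have h1 := (hθ (a + ξ)).mul_sub_nonneg h
    have h2 : (θ (a + ξ) - a) ^ 2 ≤ 0 := by nlinarith
    have h3 : θ (a + ξ) - a = 0 := by simpa using le_antisymm h2 (sq_nonneg _)
    linarith

/-! ### The fixed-point equation along the graph of the subdifferential -/

lemma le_one_sub_mul {ξ : ℝ} (hρ : 0 ≤ ρ) (hρH : ρ * H < 1) (hβ : β ≤ 1) (hξ : ξ ≤ H) :
    β ≤ 1 - (1 - β) * ρ * ξ := by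
  have h1 : ρ * ξ ≤ 1 := (mul_le_mul_of_nonneg_left hξ hρ).trans hρH.le
  nlinarith

/-- The defect `g` of the equation is continuous along the parametrized graph. At parameter `-ρ C`
the bound `ξ ≥ 0` gives `θ ≤ -ρ C` and `g ≥ 0`; at parameter `H` the bound `ξ ≤ H` gives `θ ≥ 0`,
and the tangent intercept, at most `f 0 < 0`, gives `g ≤ 0`. -/
lemma exists_isSubgradient_of_neg (hconv : ConvexOn ℝ univ f) (hcont : Continuous f)
    (hmono : Monotone f) (hH : ∀ a b, a ≤ b → f b ≤ f a + H * (b - a))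
    (hC0 : 0 ≤ C) (hC : ∀ θ, -C ≤ f θ) (hρ : 0 < ρ) (hρH : ρ * H < 1) (hβ : β ∈ Ioc (0 : ℝ) 1)
    (h0 : f 0 < 0) :
    ∃ θ ξ, IsSubgradient f θ ξ ∧ θ * (1 - (1 - β) * ρ * ξ) = β * ρ * f θ := by
  obtain ⟨θ, hθ, -, hsub, -⟩ := exists_continuous_parametrization hconv hcont hC
  set g : ℝ → ℝ := fun x => β * ρ * f (θ x) - θ x * (1 - (1 - β) * ρ * (x - θ x)) with hg
  have hgc : Continuous g := by fun_prop
  have hβ0 := hβ.1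
  have hlow : 0 ≤ g (-(ρ * C)) := by
    have h1 := (hsub (-(ρ * C))).nonneg hmono
    have h2 := le_one_sub_mul hρ.le hρH hβ.2 ((hsub (-(ρ * C))).le hH)
    have h3 := hC (θ (-(ρ * C)))
    have h4 : β * ρ * (-C) ≤ β * ρ * f (θ (-(ρ * C))) := by gcongr
    have h5 : 0 ≤ ρ * C := by positivity
    have h6 : ρ * C * β ≤
        -θ (-(ρ * C)) * (1 - (1 - β) * ρ * (-(ρ * C) - θ (-(ρ * C)))) :=
      mul_le_mul (by linarith) h2 hβ0.le (by linarith)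
    simp only [hg]
    linarith
  have hhigh : g H ≤ 0 := by
    have h1 := (hsub H).le hH
    have h2 := (hsub H) 0
    have h3 : β * ρ * (f (θ H) + (H - θ H) * (0 - θ H)) ≤ 0 :=
      mul_nonpos_of_nonneg_of_nonpos (by positivity) (by linarith)
    have h4 : 0 ≤ θ H * (1 - ρ * (H - θ H)) := by
      have : ρ * (H - θ H) ≤ ρ * H := mul_le_mul_of_nonneg_left h1 hρ.le
      exact mul_nonneg (by linarith) (by linarith)
    simp only [hg]
    nlinarith
  obtain ⟨x, hx⟩ : (0 : ℝ) ∈ range g :=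
    mem_range_of_exists_le_of_exists_ge hgc ⟨H, hhigh⟩ ⟨_, hlow⟩
  exact ⟨θ x, x - θ x, hsub x, by simp only [hg] at hx; linarith⟩

/-- The pair `(θ₂, ξ₂)` is a supersolution, and a point of the graph above `θ = 0` is a subsolution
because `f 0 > 0`. A zero of the defect lies on the arc between them, where `0 ≤ θ ≤ θ₂`. -/
lemma exists_isSubgradient_of_pos (hconv : ConvexOn ℝ univ f) (hcont : Continuous f)
    (hmono : Monotone f) (hH : ∀ a b, a ≤ b → f b ≤ f a + H * (b - a))
    (hC : ∀ θ, -C ≤ f θ) (hρ : 0 < ρ) (hβ : 0 < β)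
    (h0 : 0 < f 0) {θ₂ ξ₂ : ℝ} (h₂ : IsSubgradient f θ₂ ξ₂) (hθ₂ : 0 < θ₂)
    (hle : β * ρ * f θ₂ ≤ θ₂ * (1 - (1 - β) * ρ * ξ₂)) :
    ∃ θ ξ, IsSubgradient f θ ξ ∧ 0 ≤ θ ∧ θ ≤ θ₂ ∧
      θ * (1 - (1 - β) * ρ * ξ) = β * ρ * f θ := by
  obtain ⟨θ, hθ, hθm, hsub, huniq⟩ := exists_continuous_parametrization hconv hcont hC
  set g : ℝ → ℝ := fun x => β * ρ * f (θ x) - θ x * (1 - (1 - β) * ρ * (x - θ x)) with hg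
  have hgc : Continuous g := by fun_prop
  obtain ⟨x₀, hx₀⟩ : (0 : ℝ) ∈ range θ := mem_range_of_exists_le_of_exists_ge hθ
    ⟨0, by linarith [(hsub 0).nonneg hmono]⟩ ⟨H, by linarith [(hsub H).le hH]⟩
  have e₂ := huniq _ _ h₂
  have hx : x₀ ≤ θ₂ + ξ₂ := by
    by_contra! hlt
    have := hθm hlt.le
    linarith
  have hg0 : 0 ≤ g x₀ := by
    simp only [hg, hx₀, zero_mul, sub_zero]
    positivity
  have hg2 : g (θ₂ + ξ₂) ≤ 0 := by
    simp only [hg, e₂, add_sub_cancel_left]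
    linarith
  obtain ⟨x, hxmem, hgx⟩ := intermediate_value_Icc' hx hgc.continuousOn ⟨hg2, hg0⟩
  refine ⟨θ x, x - θ x, hsub x, ?_, ?_, by simp only [hg] at hgx; linarith⟩
  · rw [← hx₀]
    exact hθm hxmem.1
  · calc θ x ≤ θ (θ₂ + ξ₂) := hθm hxmem.2
      _ = θ₂ := e₂

/-- If `θ₁ < θ₂ < 0`, convexity orders the slopes, and the tangent at `θ₂` lies below `f` at `θ₁`.
With `-θᵢ Lᵢ = βᵢ Aᵢ` these relations would force `β₂ < β₁`. -/
lemma le_of_isSubgradient_of_neg (hH : ∀ a b, a ≤ b → f b ≤ f a + H * (b - a))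
    (hρ : 0 < ρ) (hρH : ρ * H < 1) {β₁ β₂ θ₁ θ₂ ξ₁ ξ₂ : ℝ} (hβ₁ : β₁ ∈ Ioc (0 : ℝ) 1)
    (hβ : β₁ ≤ β₂) (h₁ : IsSubgradient f θ₁ ξ₁) (h₂ : IsSubgradient f θ₂ ξ₂)
    (hθ₂ : θ₂ < 0)
    (e₁ : θ₁ * (1 - (1 - β₁) * ρ * ξ₁) = β₁ * ρ * f θ₁)
    (e₂ : θ₂ * (1 - (1 - β₂) * ρ * ξ₂) = β₂ * ρ * f θ₂) : θ₂ ≤ θ₁ := by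
  by_contra! hlt
  have hβ10 := hβ₁.1
  have hL : ∀ {θ ξ}, IsSubgradient f θ ξ → 0 < 1 - ρ * ξ := fun {θ ξ} h => by
    have := mul_le_mul_of_nonneg_left (h.le hH) hρ.le
    linarith
  have hL₁ := hL h₁
  have hL₂ := hL h₂
  have hξ : ξ₁ ≤ ξ₂ := by
    by_contra! h
    have := h₁.mul_sub_nonneg h₂
    nlinarith
  -- the intercepts of the two tangents, scaled by `-ρ`
  set A₁ := -(ρ * (f θ₁ - θ₁ * ξ₁)) with hA₁
  set A₂ := -(ρ * (f θ₂ - θ₂ * ξ₂)) with hA₂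
  set L₁ := 1 - ρ * ξ₁ with hL₁'
  set L₂ := 1 - ρ * ξ₂ with hL₂'
  have eq₁ : -θ₁ * L₁ = β₁ * A₁ := by rw [hL₁', hA₁]; linarith
  have eq₂ : -θ₂ * L₂ = β₂ * A₂ := by rw [hL₂', hA₂]; linarith
  have hLL : 0 ≤ L₁ - L₂ := by
    have := mul_le_mul_of_nonneg_left hξ hρ.le
    linarith
  have hA₁0 : 0 < A₁ := by
    have : 0 < β₁ * A₁ := by rw [← eq₁]; exact mul_pos (by linarith) hL₁
    exact pos_of_mul_pos_right this hβ10.le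
  have htan : A₁ ≤ A₂ + -θ₁ * (L₁ - L₂) := by
    have := mul_le_mul_of_nonneg_left (h₂ θ₁) hρ.le
    rw [hA₁, hA₂, hL₁', hL₂']
    nlinarith
  have hA₂0 : 0 < A₂ := by
    have hβ20 : 0 < β₂ := hβ10.trans_le hβ
    have : 0 < β₂ * A₂ := by rw [← eq₂]; exact mul_pos (by linarith) hL₂
    exact pos_of_mul_pos_right this hβ20.le
  have hp : 0 ≤ A₂ - -θ₁ * L₂ := by
    have : -θ₁ * L₁ ≤ A₁ := by rw [eq₁]; nlinarith [hβ₁.2]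
    linarith
  -- The two sides differ by `-θ₁ (L₁ - L₂) (A₂ + θ₁ L₂)`. The chain `i3`, `i2`, `i1` then gives `β₂
  -- A₁ A₂ < β₁ A₁ A₂`.
  have i1 : -θ₁ * L₂ * (A₂ + -θ₁ * (L₁ - L₂)) ≤ -θ₁ * L₁ * A₂ := by
    have := mul_nonneg (mul_nonneg (by linarith : 0 ≤ -θ₁) hLL) hp
    linarith
  have i2 : -θ₁ * L₂ * A₁ ≤ -θ₁ * L₂ * (A₂ + -θ₁ * (L₁ - L₂)) :=
    mul_le_mul_of_nonneg_left htan (mul_nonneg (by linarith) hL₂.le)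
  have i3 : -θ₂ * L₂ * A₁ < -θ₁ * L₂ * A₁ := by gcongr
  rw [eq₂] at i3
  rw [eq₁] at i1
  have i4 : β₁ * (A₁ * A₂) ≤ β₂ * (A₁ * A₂) := by gcongr
  linarith

/-! ### The contraction -/

lemma exists_eq_mul_comp (hmono : Monotone f) (hH0 : 0 ≤ H)
    (hH : ∀ a b, a ≤ b → f b ≤ f a + H * (b - a)) (hρ : 0 ≤ ρ) (hρH : ρ * H < 1) {κ : ℝ}
    (hκ : κ ∈ Icc (0 : ℝ) 1) : ∃ θ, θ = ρ * f (κ * θ) := by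
  have hc : ContractingWith (ρ * H).toNNReal fun θ => ρ * f (κ * θ) := by
    refine ⟨by rwa [Real.toNNReal_lt_one], LipschitzWith.of_dist_le_mul fun a b => ?_⟩
    have h1 := (lipschitzWith_of_monotone hmono hH0 hH).dist_le_mul (κ * a) (κ * b)
    rw [Real.coe_toNNReal _ hH0] at h1
    rw [Real.coe_toNNReal _ (by positivity)]
    simp only [Real.dist_eq, ← mul_sub, abs_mul, abs_of_nonneg hρ, abs_of_nonneg hκ.1] at h1 ⊢
    rw [mul_assoc]
    refine mul_le_mul_of_nonneg_left (h1.trans ?_) hρ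
    refine mul_le_mul_of_nonneg_left ?_ hH0
    exact mul_le_of_le_one_left (abs_nonneg _) hκ.2
  exact ⟨_, hc.fixedPoint_isFixedPt.symm⟩

lemma eq_of_eq_mul_comp (hH : ∀ a b, a ≤ b → f b ≤ f a + H * (b - a)) (hH0 : 0 ≤ H)
    (hρ : 0 ≤ ρ) (hρH : ρ * H < 1) {κ : ℝ} (hκ : κ ∈ Icc (0 : ℝ) 1) {a b : ℝ}
    (ha : a = ρ * f (κ * a)) (hb : b = ρ * f (κ * b)) : a = b := by
  wlog hab : a ≤ b generalizing a b
  · exact (this hb ha (le_of_not_ge hab)).symm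
  have h1 := mul_le_mul_of_nonneg_left
    (hH (κ * a) (κ * b) (mul_le_mul_of_nonneg_left hab hκ.1)) hρ
  have h2 : κ * (b - a) ≤ 1 * (b - a) := mul_le_mul_of_nonneg_right hκ.2 (by linarith)
  have h3 := mul_le_mul_of_nonneg_left h2 (mul_nonneg hρ hH0)
  nlinarith

lemma pos_of_eq_mul_comp (hH : ∀ a b, a ≤ b → f b ≤ f a + H * (b - a)) (hH0 : 0 ≤ H)
    (hρ : 0 < ρ) (hρH : ρ * H < 1) {κ : ℝ} (hκ : κ ∈ Icc (0 : ℝ) 1) {a : ℝ}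
    (ha : a = ρ * f (κ * a)) (h0 : 0 < f 0) : 0 < a := by
  by_contra! hle
  have h1 := mul_le_mul_of_nonneg_left
    (hH (κ * a) 0 (mul_nonpos_of_nonneg_of_nonpos hκ.1 hle)) hρ.le
  have h2 : κ * (-a) ≤ 1 * (-a) := mul_le_mul_of_nonneg_right hκ.2 (by linarith)
  have h3 := mul_le_mul_of_nonneg_left h2 (mul_nonneg hρ.le hH0)
  have h4 : 0 < ρ * f 0 := by positivity
  nlinarith

lemma neg_of_eq_mul_comp (hH : ∀ a b, a ≤ b → f b ≤ f a + H * (b - a)) (hH0 : 0 ≤ H)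
    (hρ : 0 < ρ) (hρH : ρ * H < 1) {κ : ℝ} (hκ : κ ∈ Icc (0 : ℝ) 1) {a : ℝ}
    (ha : a = ρ * f (κ * a)) (h0 : f 0 < 0) : a < 0 := by
  by_contra! hle
  have h1 := mul_le_mul_of_nonneg_left (hH 0 (κ * a) (mul_nonneg hκ.1 hle)) hρ.le
  have h2 : κ * a ≤ 1 * a := mul_le_mul_of_nonneg_right hκ.2 hle
  have h3 := mul_le_mul_of_nonneg_left h2 (mul_nonneg hρ.le hH0)
  have h4 : ρ * f 0 < 0 := mul_neg_of_pos_of_neg hρ h0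
  nlinarith

end Subgradient

/-- Bounded demands accumulate only at maximizers of the limit problem. This replaces convergence
when the limit problem has several maximizers. -/
lemma Model.eventually_lt_of_forall_mem_demandSet (M : Model) {ι : Type*} {l : Filter ι}
    {p θ y : ι → ℝ} {p₀ θ₀ C m : ℝ} (hp : Tendsto p l (𝓝 p₀)) (hθ : Tendsto θ l (𝓝 θ₀))
    (h : ∀ᶠ i in l, y i ∈ M.demandSet (p i) (θ i)) (hC : ∀ᶠ i in l, y i ≤ C)
    {v : ℝ → ℝ} (hv : Continuous v) (hm : ∀ z ∈ M.demandSet p₀ θ₀, v z < m) :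
    ∀ᶠ i in l, v (y i) < m := by
  by_contra hcon
  rw [not_eventually] at hcon
  have hK : IsCompact (Icc 0 C ∩ {z | m ≤ v z}) :=
    isCompact_Icc.inter_right (isClosed_le continuous_const hv)
  obtain ⟨a, ha, hclus⟩ := hK.exists_mapClusterPt_of_frequently (f := y) (l := l) (by
    refine (hcon.and_eventually (h.and hC)).mono fun i hi => ?_
    exact ⟨⟨hi.2.1.1, hi.2.2⟩, not_lt.1 hi.1⟩)
  obtain ⟨g, hg, hyg⟩ := mapClusterPt_iff_ultrafilter.1 hclus
  have hne : (g : Filter ι).NeBot := g.neBot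
  exact absurd (hm a (M.mem_demandSet_of_tendsto (hp.mono_left hg) (hθ.mono_left hg) hyg (hg h)))
    (not_lt.2 ha.2)

/-- The return that is optimal when the budget constraint is replaced by the price `c`. -/
noncomputable def optimalReturn {Ω : Type*} (M : Model) (B : ℝ≥0 → Ω → ℝ) (c θ : ℝ) (ω : Ω) : ℝ :=
  M.demand (c * periodKernel M B ω) θ

/-- An upper bound for `optimalReturn`, for prices at least `c` and preferences at most `T`. -/
noncomputable def returnBound {Ω : Type*} (M : Model) (B : ℝ≥0 → Ω → ℝ) (c T : ℝ) (ω : Ω) : ℝ :=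
  (1 + T + M.k * M.γ ^ M.α) / (c * periodKernel M B ω) +
    ((1 + T + M.k * M.γ ^ M.α) / (c * periodKernel M B ω)) ^ (1 / (1 - M.α))

/-! ### Lagrangian duality and the binding budget constraint -/

section Duality

variable {Ω : Type*} [MeasurableSpace Ω] {P : Measure Ω} {B : ℝ≥0 → Ω → ℝ} {M : Model}

omit [MeasurableSpace Ω] in
lemma optimalReturn_mem {c : ℝ} (hc : 0 < c) (θ : ℝ) (ω : Ω) :
    optimalReturn M B c θ ω ∈ M.demandSet (c * periodKernel M B ω) θ :=
  M.demand_mem (mul_pos hc (periodKernel_pos ω)) θ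

omit [MeasurableSpace Ω] in
lemma optimalReturn_nonneg {c : ℝ} (hc : 0 < c) (θ : ℝ) (ω : Ω) :
    0 ≤ optimalReturn M B c θ ω := (optimalReturn_mem hc θ ω).1

lemma measurable_augmentedSigma_optimalReturn (hB : IsBrownianReal B P) {c : ℝ} (hc : 0 < c)
    (θ : ℝ) : Measurable[augmentedSigma P B M.τ.toNNReal] (optimalReturn M B c θ) := by
  have h1 : Measurable fun z : ℝ => M.demand (Real.exp (Real.log (c * z))) θ :=
    (M.antitone_demand_exp θ).measurable.comp (by fun_prop)
  have h2 := h1.comp (measurable_augmentedSigma_periodKernel (M := M) hB)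
  convert h2 using 1
  funext ω
  simp [optimalReturn, Real.exp_log (mul_pos hc (periodKernel_pos ω))]

omit [MeasurableSpace Ω] in
lemma optimalReturn_le {c c' θ T : ℝ} (hc : 0 < c) (hc' : c ≤ c') (hθ : θ ≤ T) (hT : 0 ≤ T)
    (ω : Ω) : optimalReturn M B c' θ ω ≤ returnBound M B c T ω := by
  have hz := periodKernel_pos (M := M) (B := B) ω
  have h := M.le_of_mem_demandSet (mul_pos (hc.trans_le hc') hz) hθ hT
    (optimalReturn_mem (hc.trans_le hc') θ ω)
  refine h.trans ?_
  have hkγ : 0 ≤ M.k * M.γ ^ M.α := mul_nonneg M.k_nonneg (Real.rpow_nonneg M.γ_pos.le _)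
  have hα : 0 < 1 - M.α := by linarith [M.α_lt_one]
  have h1 : (1 + T + M.k * M.γ ^ M.α) / (c' * periodKernel M B ω) ≤
      (1 + T + M.k * M.γ ^ M.α) / (c * periodKernel M B ω) := by gcongr
  have h0 : 0 ≤ (1 + T + M.k * M.γ ^ M.α) / (c' * periodKernel M B ω) :=
    div_nonneg (by positivity) (mul_pos (hc.trans_le hc') hz).le
  unfold returnBound
  gcongr

omit [MeasurableSpace Ω] in
lemma returnBound_eq {c T : ℝ} (hc : 0 < c) (hT : 0 ≤ T) (ω : Ω) :
    returnBound M B c T ω = (1 + T + M.k * M.γ ^ M.α) / c * periodKernel M B ω ^ (-1 : ℝ) +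
      ((1 + T + M.k * M.γ ^ M.α) / c) ^ (1 / (1 - M.α)) *
        periodKernel M B ω ^ (-(1 / (1 - M.α))) := by
  have hkγ : 0 ≤ M.k * M.γ ^ M.α := mul_nonneg M.k_nonneg (Real.rpow_nonneg M.γ_pos.le _)
  have hz := periodKernel_pos (M := M) (B := B) ω
  rw [returnBound, ← div_div, Real.div_rpow (by positivity) hz.le, Real.rpow_neg hz.le,
    Real.rpow_neg hz.le, Real.rpow_one, div_eq_mul_inv _ (periodKernel M B ω),
    div_eq_mul_inv _ (periodKernel M B ω ^ _)]

omit [MeasurableSpace Ω] in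
lemma periodKernel_mul_returnBound_eq {c T : ℝ} (hc : 0 < c) (hT : 0 ≤ T) (ω : Ω) :
    periodKernel M B ω * returnBound M B c T ω = (1 + T + M.k * M.γ ^ M.α) / c +
      ((1 + T + M.k * M.γ ^ M.α) / c) ^ (1 / (1 - M.α)) *
        periodKernel M B ω ^ (1 - 1 / (1 - M.α)) := by
  have hz := periodKernel_pos (M := M) (B := B) ω
  rw [returnBound_eq hc hT, sub_eq_add_neg 1 (1 / (1 - M.α)), Real.rpow_add hz, Real.rpow_one,
    Real.rpow_neg_one]
  field_simp

variable [IsProbabilityMeasure P]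

omit [IsProbabilityMeasure P] in
lemma integrable_returnBound (hB : IsBrownianReal B P) {c T : ℝ} (hc : 0 < c) (hT : 0 ≤ T) :
    Integrable (returnBound M B c T) P := by
  have : returnBound M B c T = fun ω => _ := funext fun ω => returnBound_eq hc hT ω
  rw [this]
  exact ((integrable_periodKernel_rpow hB _).const_mul _).add
    ((integrable_periodKernel_rpow hB _).const_mul _)

lemma integrable_periodKernel_mul_returnBound (hB : IsBrownianReal B P) {c T : ℝ} (hc : 0 < c)
    (hT : 0 ≤ T) : Integrable (fun ω => periodKernel M B ω * returnBound M B c T ω) P := by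
  simp_rw [periodKernel_mul_returnBound_eq hc hT]
  exact (integrable_const _).add ((integrable_periodKernel_rpow hB _).const_mul _)

omit [MeasurableSpace Ω] in
lemma Model.rpow_le_one_add (M : Model) {y : ℝ} (hy : 0 ≤ y) : y ^ M.α ≤ 1 + y := by
  rcases le_total y 1 with h | h
  · linarith [Real.rpow_le_one hy h M.α_pos.le]
  · have := Real.rpow_le_rpow_of_exponent_le h M.α_lt_one.le
    rw [Real.rpow_one] at this
    linarith

variable [P.IsComplete]

omit [IsProbabilityMeasure P] in
lemma measurable_optimalReturn (hB : IsBrownianReal B P) {c : ℝ} (hc : 0 < c) (θ : ℝ) :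
    Measurable (optimalReturn M B c θ) :=
  (measurable_augmentedSigma_optimalReturn hB hc θ).mono (augmentedSigma_le hB _) le_rfl

omit [MeasurableSpace Ω] [IsProbabilityMeasure P] [P.IsComplete] in
lemma norm_periodKernel_mul_optimalReturn_le {c c' θ T : ℝ} (hc : 0 < c) (hc' : c ≤ c')
    (hθ : θ ≤ T) (hT : 0 ≤ T) (ω : Ω) : ‖periodKernel M B ω * optimalReturn M B c' θ ω‖ ≤
      periodKernel M B ω * returnBound M B c T ω := by
  have hz := periodKernel_pos (M := M) (B := B) ω
  rw [Real.norm_of_nonneg (mul_nonneg hz.le (optimalReturn_nonneg (hc.trans_le hc') θ ω))]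
  exact mul_le_mul_of_nonneg_left (optimalReturn_le hc hc' hθ hT ω) hz.le

omit [MeasurableSpace Ω] [IsProbabilityMeasure P] [P.IsComplete] in
lemma norm_optimalReturn_rpow_le {c c' θ T : ℝ} (hc : 0 < c) (hc' : c ≤ c')
    (hθ : θ ≤ T) (hT : 0 ≤ T) (ω : Ω) : ‖optimalReturn M B c' θ ω ^ M.α‖ ≤
      1 + returnBound M B c T ω := by
  have h0 := optimalReturn_nonneg (M := M) (B := B) (hc.trans_le hc') θ ω
  rw [Real.norm_of_nonneg (Real.rpow_nonneg h0 _)]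
  linarith [M.rpow_le_one_add h0, optimalReturn_le (M := M) (B := B) hc hc' hθ hT ω]

lemma integrable_periodKernel_mul_optimalReturn (hB : IsBrownianReal B P) {c : ℝ} (hc : 0 < c)
    (θ : ℝ) : Integrable (fun ω => periodKernel M B ω * optimalReturn M B c θ ω) P :=
  (integrable_periodKernel_mul_returnBound hB hc (abs_nonneg θ)).mono'
    ((measurable_periodKernel hB).mul (measurable_optimalReturn hB hc θ)).aestronglyMeasurable
    (Eventually.of_forall fun ω =>
      norm_periodKernel_mul_optimalReturn_le hc le_rfl (le_abs_self θ) (abs_nonneg θ) ω)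

lemma integrable_optimalReturn_rpow (hB : IsBrownianReal B P) {c : ℝ} (hc : 0 < c)
    (θ : ℝ) : Integrable (fun ω => optimalReturn M B c θ ω ^ M.α) P :=
  ((integrable_const 1).add (integrable_returnBound hB hc (abs_nonneg θ))).mono'
    ((measurable_optimalReturn hB hc θ).pow_const _).aestronglyMeasurable
    (Eventually.of_forall fun ω =>
      norm_optimalReturn_rpow_le hc le_rfl (le_abs_self θ) (abs_nonneg θ) ω)

lemma integrable_F_optimalReturn (hB : IsBrownianReal B P) {c : ℝ} (hc : 0 < c) (θ θ' : ℝ) :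
    Integrable (fun ω => M.F (optimalReturn M B c θ ω) θ') P :=
  integrable_F_of_integrable_rpow (measurable_optimalReturn hB hc θ)
    (Eventually.of_forall fun ω => optimalReturn_nonneg hc θ ω)
    (integrable_optimalReturn_rpow hB hc θ) θ'

omit [IsProbabilityMeasure P] [P.IsComplete] in
-- Demand is multivalued only at countably many prices, which `c₀ Z_τ` almost surely avoids.
lemma ae_tendsto_optimalReturn (hB : IsBrownianReal B P) {c₀ θ₀ : ℝ} (hc₀ : 0 < c₀) :
    ∀ᵐ ω ∂P, Tendsto (fun q : ℝ × ℝ => optimalReturn M B q.1 q.2 ω) (𝓝 (c₀, θ₀))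
      (𝓝 (optimalReturn M B c₀ θ₀ ω)) := by
  filter_upwards [ae_log_periodKernel_notMem (M := M) hB (M.countable_not_subsingleton θ₀) hc₀] with ω hω
  have hz := periodKernel_pos (M := M) (B := B) ω
  rw [not_not, Real.exp_log (mul_pos hc₀ hz)] at hω
  have hc : ∀ᶠ q : ℝ × ℝ in 𝓝 (c₀, θ₀), c₀ / 2 < q.1 :=
    continuousAt_fst.eventually (lt_mem_nhds (half_lt_self hc₀))
  have hθ : ∀ᶠ q : ℝ × ℝ in 𝓝 (c₀, θ₀), q.2 < |θ₀| + 1 :=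
    continuousAt_snd.eventually (gt_mem_nhds (by
      show θ₀ < _
      linarith [le_abs_self θ₀]))
  refine M.tendsto_of_subsingleton (p := fun q : ℝ × ℝ => q.1 * periodKernel M B ω)
    (θ := fun q : ℝ × ℝ => q.2) (C := returnBound M B (c₀ / 2) (|θ₀| + 1) ω)
    (Continuous.tendsto' (by fun_prop) _ _ rfl) (Continuous.tendsto' (by fun_prop) _ _ rfl) ?_ ?_
    fun z hz => hω hz (optimalReturn_mem hc₀ θ₀ ω)
  · filter_upwards [hc] with q hq using optimalReturn_mem (by linarith) _ _
  · filter_upwards [hc, hθ] with q hq hq'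
    exact optimalReturn_le (by linarith) hq.le hq'.le (by positivity) ω

lemma continuousOn_cost (hB : IsBrownianReal B P) (θ : ℝ) :
    ContinuousOn (fun c => ∫ ω, periodKernel M B ω * optimalReturn M B c θ ω ∂P) (Ioi 0) := by
  intro c₀ hc₀
  have hc₀' : 0 < c₀ := hc₀
  have hc : ∀ᶠ c in 𝓝 c₀, c₀ / 2 < c := lt_mem_nhds (half_lt_self hc₀')
  refine ContinuousAt.continuousWithinAt ?_
  refine tendsto_integral_filter_of_dominated_convergence
    (fun ω => periodKernel M B ω * returnBound M B (c₀ / 2) |θ| ω) ?_ ?_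
    (integrable_periodKernel_mul_returnBound hB (by linarith) (abs_nonneg θ)) ?_
  · filter_upwards [hc] with c h
    exact (integrable_periodKernel_mul_optimalReturn hB (by linarith) θ).aestronglyMeasurable
  · filter_upwards [hc] with c h
    exact Eventually.of_forall fun ω => norm_periodKernel_mul_optimalReturn_le (by linarith) h.le
      (le_abs_self θ) (abs_nonneg θ) ω
  · filter_upwards [ae_tendsto_optimalReturn (M := M) hB (θ₀ := θ) hc₀'] with ω hω
    exact (hω.comp (Continuous.tendsto' (f := fun c => (c, θ)) (by fun_prop) c₀ _ rfl)).const_mul _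

lemma tendsto_integral_optimalReturn_rpow (hB : IsBrownianReal B P) {c : ℝ} (hc : 0 < c) (θ : ℝ) :
    Tendsto (fun θ' => ∫ ω, optimalReturn M B c θ' ω ^ M.α ∂P) (𝓝 θ)
      (𝓝 (∫ ω, optimalReturn M B c θ ω ^ M.α ∂P)) := by
  have hθ : ∀ᶠ θ' in 𝓝 θ, θ' < |θ| + 1 := gt_mem_nhds (by linarith [le_abs_self θ])
  refine tendsto_integral_filter_of_dominated_convergence
    (fun ω => 1 + returnBound M B c (|θ| + 1) ω) ?_ ?_
    ((integrable_const _).add (integrable_returnBound hB hc (by positivity))) ?_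
  · exact Eventually.of_forall fun θ' =>
      (integrable_optimalReturn_rpow hB hc θ').aestronglyMeasurable
  · filter_upwards [hθ] with θ' h
    exact Eventually.of_forall fun ω => norm_optimalReturn_rpow_le hc le_rfl h.le (by positivity) ω
  · filter_upwards [ae_tendsto_optimalReturn (M := M) hB (θ₀ := θ) hc] with ω hω
    exact (hω.comp (Continuous.tendsto' (f := fun θ' => (c, θ')) (by fun_prop) θ _ rfl)).rpow_const
      (Or.inr M.α_pos.le)

lemma exists_cost_lt_one (hB : IsBrownianReal B P) (θ : ℝ) :
    ∃ c₀, ∀ c, c₀ ≤ c → 0 < c ∧ ∫ ω, periodKernel M B ω * optimalReturn M B c θ ω ∂P < 1 := by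
  set K := 1 + |θ| + M.k * M.γ ^ M.α
  set E := ∫ ω, periodKernel M B ω ^ (1 - 1 / (1 - M.α)) ∂P
  have hα : 0 < 1 - M.α := by linarith [M.α_lt_one]
  have h1 : Tendsto (fun c : ℝ => K / c) atTop (𝓝 0) := tendsto_const_nhds.div_atTop tendsto_id
  have h2 : Tendsto (fun c : ℝ => K / c + (K / c) ^ (1 / (1 - M.α)) * E) atTop (𝓝 0) := by
    have := h1.add ((h1.rpow_const (p := 1 / (1 - M.α)) (Or.inr (by positivity))).mul_const E)
    rwa [Real.zero_rpow (by positivity), zero_mul, add_zero] at this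
  obtain ⟨c₀, hc₀⟩ := eventually_atTop.1 ((h2.eventually (gt_mem_nhds zero_lt_one)).and
    (eventually_gt_atTop 0))
  refine ⟨c₀, fun c hc => ⟨(hc₀ c hc).2, lt_of_le_of_lt ?_ (hc₀ c hc).1⟩⟩
  have hc0 := (hc₀ c hc).2
  have h3 : ∫ ω, periodKernel M B ω * returnBound M B c |θ| ω ∂P =
      K / c + (K / c) ^ (1 / (1 - M.α)) * E := by
    simp_rw [periodKernel_mul_returnBound_eq hc0 (abs_nonneg θ)]
    rw [integral_add (integrable_const _) ((integrable_periodKernel_rpow hB _).const_mul _),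
      integral_const_mul]
    simp [K, E]
  rw [← h3]
  refine integral_mono (integrable_periodKernel_mul_optimalReturn hB hc0 θ)
    (integrable_periodKernel_mul_returnBound hB hc0 (abs_nonneg θ)) fun ω => ?_
  exact (le_abs_self _).trans
    (norm_periodKernel_mul_optimalReturn_le hc0 le_rfl (le_abs_self θ) (abs_nonneg θ) ω)

/-- Weak duality. -/
lemma Phi_le_dual (hB : IsBrownianReal B P) {c : ℝ} (hc : 0 < c) (θ : ℝ) :
    Phi M P B θ ≤ (∫ ω, (M.F (optimalReturn M B c θ ω) θ -
      c * (periodKernel M B ω * optimalReturn M B c θ ω)) ∂P) + c := by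
  refine Phi_le fun Y hY => ?_
  have hF := integrable_F_of_mem_returns hB hY θ
  have hZ := (integrable_mul_of_mem_returns hB hY).const_mul c
  have h1 : ∫ ω, (M.F (Y ω) θ - c * (periodKernel M B ω * Y ω)) ∂P ≤
      ∫ ω, (M.F (optimalReturn M B c θ ω) θ -
        c * (periodKernel M B ω * optimalReturn M B c θ ω)) ∂P := by
    refine integral_mono_ae (hF.sub hZ) ((integrable_F_optimalReturn hB hc θ θ).sub
      ((integrable_periodKernel_mul_optimalReturn hB hc θ).const_mul c)) ?_
    filter_upwards [hY.2.1] with ω hω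
    have := (optimalReturn_mem (M := M) (B := B) hc θ ω).2 _ hω
    simp only [← mul_assoc]
    exact this
  rw [integral_sub hF hZ, integral_const_mul] at h1
  have h2 := mul_le_mul_of_nonneg_left (integral_mul_le_of_mem_returns hB hY) hc.le
  unfold objective
  linarith

/-- Combines the subgradient inequality with weak duality at `θ + η`, where `F` is expanded around
`θ`. The last bracket is a Lagrangian value at `θ` minus `Φ(θ)`, which the applications bound. -/
lemma mul_le_of_isSubgradient (hB : IsBrownianReal B P) {θ s : ℝ}
    (hs : IsSubgradient (Phi M P B) θ s) {c : ℝ} (hc : 0 < c) (η : ℝ) :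
    s * η ≤ η * (∫ ω, optimalReturn M B c (θ + η) ω ^ M.α ∂P) +
      ((∫ ω, (M.F (optimalReturn M B c (θ + η) ω) θ -
        c * (periodKernel M B ω * optimalReturn M B c (θ + η) ω)) ∂P) + c - Phi M P B θ) := by
  have h1 := hs (θ + η)
  have h2 := Phi_le_dual (M := M) hB hc (θ + η)
  have hF := integrable_F_optimalReturn (M := M) hB hc (θ + η) θ
  have hZ := (integrable_periodKernel_mul_optimalReturn (M := M) hB hc (θ + η)).const_mul c
  have hα := (integrable_optimalReturn_rpow (M := M) hB hc (θ + η)).const_mul η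
  have h3 : ∫ ω, (M.F (optimalReturn M B c (θ + η) ω) (θ + η) -
      c * (periodKernel M B ω * optimalReturn M B c (θ + η) ω)) ∂P =
      η * (∫ ω, optimalReturn M B c (θ + η) ω ^ M.α ∂P) +
      ∫ ω, (M.F (optimalReturn M B c (θ + η) ω) θ -
        c * (periodKernel M B ω * optimalReturn M B c (θ + η) ω)) ∂P := by
    have hFZ : Integrable (fun ω => M.F (optimalReturn M B c (θ + η) ω) θ -
        c * (periodKernel M B ω * optimalReturn M B c (θ + η) ω)) P := hF.sub hZ
    rw [← integral_const_mul, ← integral_add hα hFZ]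
    refine integral_congr_ae (Eventually.of_forall fun ω => ?_)
    simp only [M.F_add]
    ring
  rw [h3] at h2
  rw [add_sub_cancel_left] at h1
  linarith

/-- The case of a binding budget constraint. -/
lemma exists_maximizer_of_cost_eq_one (hB : IsBrownianReal B P) {θ s : ℝ}
    (hs : IsSubgradient (Phi M P B) θ s) {c : ℝ} (hc : 0 < c)
    (hcost : ∫ ω, periodKernel M B ω * optimalReturn M B c θ ω ∂P = 1) :
    ∃ Y ∈ maximizers M P B θ, ∫ ω, Y ω ^ M.α ∂P = s := by
  have hmem : optimalReturn M B c θ ∈ returns M P B :=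
    mem_returns_of_integral_le (measurable_augmentedSigma_optimalReturn hB hc θ)
      (optimalReturn_nonneg hc θ) (integrable_periodKernel_mul_optimalReturn hB hc θ) hcost.le
  have hF := integrable_F_optimalReturn (M := M) hB hc θ θ
  have hZ := (integrable_periodKernel_mul_optimalReturn (M := M) hB hc θ).const_mul c
  have hval : (∫ ω, (M.F (optimalReturn M B c θ ω) θ -
      c * (periodKernel M B ω * optimalReturn M B c θ ω)) ∂P) + c =
      objective M P θ (optimalReturn M B c θ) := by
    rw [integral_sub hF hZ, integral_const_mul, hcost, objective]
    ring
  have hPhi : Phi M P B θ = objective M P θ (optimalReturn M B c θ) :=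
    le_antisymm (hval ▸ Phi_le_dual hB hc θ) (objective_le_Phi hB hmem θ)
  -- There is no duality gap at `θ`, and the demand for `θ` maximizes the Lagrangian pointwise, so
  -- the bracket is nonpositive. Division by `η` of either sign and `η → 0` then pin down `s`.
  have key : ∀ η, s * η ≤ η * ∫ ω, optimalReturn M B c (θ + η) ω ^ M.α ∂P := by
    intro η
    have h1 := mul_le_of_isSubgradient hB hs hc η
    have h2 : ∫ ω, (M.F (optimalReturn M B c (θ + η) ω) θ -
        c * (periodKernel M B ω * optimalReturn M B c (θ + η) ω)) ∂P ≤
        ∫ ω, (M.F (optimalReturn M B c θ ω) θ -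
          c * (periodKernel M B ω * optimalReturn M B c θ ω)) ∂P := by
      refine integral_mono ((integrable_F_optimalReturn hB hc _ θ).sub
        ((integrable_periodKernel_mul_optimalReturn hB hc _).const_mul c)) (hF.sub hZ) fun ω => ?_
      have := (optimalReturn_mem (M := M) (B := B) hc θ ω).2 _
        (optimalReturn_nonneg (M := M) (B := B) hc (θ + η) ω)
      simp only [← mul_assoc]
      exact this
    linarith
  refine ⟨_, ⟨hmem, fun Y hY => hPhi ▸ objective_le_Phi hB hY θ⟩, ?_⟩
  have hlim : Tendsto (fun η => ∫ ω, optimalReturn M B c (θ + η) ω ^ M.α ∂P) (𝓝 0)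
      (𝓝 (∫ ω, optimalReturn M B c θ ω ^ M.α ∂P)) :=
    (tendsto_integral_optimalReturn_rpow hB hc θ).comp
      (Continuous.tendsto' (f := fun η => θ + η) (by fun_prop) 0 _ (add_zero θ))
  refine le_antisymm ?_ ?_
  · refine le_of_tendsto (hlim.mono_left (nhdsWithin_le_nhds (s := Iio 0))) ?_
    filter_upwards [self_mem_nhdsWithin] with η hη
    have hη' : η < 0 := hη
    have := key η
    by_contra! hlt
    nlinarith
  · refine ge_of_tendsto (hlim.mono_left (nhdsWithin_le_nhds (s := Ioi 0))) ?_
    filter_upwards [self_mem_nhdsWithin] with η hη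
    have hη' : 0 < η := hη
    have := key η
    by_contra! hlt
    nlinarith

end Duality

/-! ### The slack budget constraint -/

section Slack

variable {Ω : Type*} [MeasurableSpace Ω] {P : Measure Ω} {B : ℝ≥0 → Ω → ℝ} {M : Model}
  [IsProbabilityMeasure P] [P.IsComplete]

omit [IsProbabilityMeasure P] in
lemma continuous_integral_ite (hB : IsBrownianReal B P) {g : Ω → ℝ} (hg : Integrable g P) :
    Continuous fun t : ℝ => ∫ ω, (if periodKernel M B ω ≤ t then g ω else 0) ∂P := by
  refine continuous_iff_continuousAt.2 fun t => ?_
  refine tendsto_integral_filter_of_dominated_convergence (fun ω => ‖g ω‖) ?_ ?_ hg.norm ?_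
  · exact Eventually.of_forall fun t => hg.aestronglyMeasurable.indicator
      (measurableSet_le (measurable_periodKernel (M := M) hB) measurable_const)
  · refine Eventually.of_forall fun t => Eventually.of_forall fun ω => ?_
    split_ifs <;> simp
  · filter_upwards [ae_periodKernel_ne (M := M) hB t] with ω hω
    refine tendsto_const_nhds.congr' ?_
    rcases lt_or_gt_of_ne hω with h | h
    · filter_upwards [lt_mem_nhds h] with t' ht'
      rw [if_pos h.le, if_pos ht'.le]
    · filter_upwards [gt_mem_nhds h] with t' ht'
      rw [if_neg (not_le.2 h), if_neg (not_le.2 ht')]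

omit [IsProbabilityMeasure P] in
lemma tendsto_integral_ite (hB : IsBrownianReal B P) {g : Ω → ℝ} (hg : Integrable g P) :
    Tendsto (fun t : ℝ => ∫ ω, (if periodKernel M B ω ≤ t then g ω else 0) ∂P) atTop
      (𝓝 (∫ ω, g ω ∂P)) := by
  refine tendsto_integral_filter_of_dominated_convergence (fun ω => ‖g ω‖) ?_ ?_ hg.norm ?_
  · exact Eventually.of_forall fun t => hg.aestronglyMeasurable.indicator
      (measurableSet_le (measurable_periodKernel (M := M) hB) measurable_const)
  · refine Eventually.of_forall fun t => Eventually.of_forall fun ω => ?_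
    split_ifs <;> simp
  · refine Eventually.of_forall fun ω => tendsto_const_nhds.congr' ?_
    filter_upwards [eventually_ge_atTop (periodKernel M B ω)] with t ht
    rw [if_pos ht]

omit [P.IsComplete] in
lemma integral_periodKernel_pos (hB : IsBrownianReal B P) : 0 < ∫ ω, periodKernel M B ω ∂P := by
  rw [integral_pos_iff_support_of_nonneg (fun ω => (periodKernel_pos ω).le)
    (integrable_periodKernel hB)]
  have : Function.support (periodKernel M B) = univ :=
    eq_univ_of_forall fun ω => (periodKernel_pos ω).ne'
  simp [this]

omit [IsProbabilityMeasure P] in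
lemma integrable_ite (hB : IsBrownianReal B P) {g : Ω → ℝ} (hg : Integrable g P) (t : ℝ) :
    Integrable (fun ω => if periodKernel M B ω ≤ t then g ω else 0) P :=
  hg.indicator (measurableSet_le (measurable_periodKernel (M := M) hB) measurable_const)

/-- If the budget constraint never binds, then the least maximizer of `F(·; θ)` exists and is
affordable. -/
lemma exists_least_of_cost_le_one (hB : IsBrownianReal B P) {θ : ℝ}
    (hcost : ∀ c, 0 < c → ∫ ω, periodKernel M B ω * optimalReturn M B c θ ω ∂P ≤ 1) :
    ∃ y ∈ M.demandSet 0 θ, (∀ z ∈ M.demandSet 0 θ, y ≤ z) ∧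
      y * ∫ ω, periodKernel M B ω ∂P ≤ 1 := by
  have hZ := integrable_periodKernel (M := M) hB
  obtain ⟨z₀, hz₀, hX⟩ := ((eventually_gt_atTop (0 : ℝ)).and
    ((tendsto_integral_ite (M := M) hB hZ).eventually
      (lt_mem_nhds (integral_periodKernel_pos hB)))).exists
  set X := ∫ ω, (if periodKernel M B ω ≤ z₀ then periodKernel M B ω else 0) ∂P
  -- With multiplier `p / z₀`, the price on `{Z_τ ≤ z₀}` is at most `p`, so the demand there is at
  -- least `demand p θ` and already costs `demand p θ * X`.
  have hbound : ∀ p, 0 < p → M.demand p θ ≤ 1 / X := by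
    intro p hp
    have hc : 0 < p / z₀ := by positivity
    rw [le_div_iff₀ hX, ← integral_const_mul]
    refine le_trans (integral_mono ((integrable_ite hB hZ z₀).const_mul _)
      (integrable_periodKernel_mul_optimalReturn hB hc θ) fun ω => ?_) (hcost _ hc)
    have hz := periodKernel_pos (M := M) (B := B) ω
    dsimp only
    split_ifs with h
    · rw [mul_comm]
      refine mul_le_mul_of_nonneg_left (M.demand_antitone θ (by positivity) ?_) hz.le
      calc p / z₀ * periodKernel M B ω ≤ p / z₀ * z₀ := by gcongr
        _ = p := by field_simp
    · rw [mul_zero]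
      exact mul_nonneg hz.le (optimalReturn_nonneg hc θ ω)
  have hanti : AntitoneOn (fun p => M.demand p θ) (Ioi 0) := fun p hp p' _ h =>
    M.demand_antitone θ hp h
  have hlim : Tendsto (fun p => M.demand p θ) (𝓝[>] 0)
      (𝓝 (sSup ((fun p => M.demand p θ) '' Ioi 0))) := by
    refine hanti.tendsto_nhdsGT ⟨1 / X, ?_⟩
    rintro _ ⟨p, hp, rfl⟩
    exact hbound p hp
  set y := sSup ((fun p => M.demand p θ) '' Ioi 0)
  refine ⟨y, ?_, fun z hz => ?_, ?_⟩
  · refine M.mem_demandSet_of_tendsto (p := fun p => p) (θ := fun _ => θ)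
      (tendsto_id.mono_left nhdsWithin_le_nhds) tendsto_const_nhds hlim ?_
    filter_upwards [self_mem_nhdsWithin] with p hp using M.demand_mem hp θ
  · refine le_of_tendsto hlim ?_
    filter_upwards [self_mem_nhdsWithin] with p hp
    exact M.demandSet_antitone hp hz (M.demand_mem hp θ)
  · rw [mul_comm, ← integral_mul_const]
    refine le_of_tendsto (tendsto_integral_filter_of_dominated_convergence (l := 𝓝[>] (0 : ℝ))
      (F := fun c ω => periodKernel M B ω * optimalReturn M B c θ ω)
      (fun ω => periodKernel M B ω * (1 / X)) ?_ ?_ (hZ.mul_const _) ?_) ?_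
    · filter_upwards [self_mem_nhdsWithin] with c hc
      exact (integrable_periodKernel_mul_optimalReturn hB hc θ).aestronglyMeasurable
    · filter_upwards [self_mem_nhdsWithin] with c hc
      refine Eventually.of_forall fun ω => ?_
      have hz := periodKernel_pos (M := M) (B := B) ω
      rw [Real.norm_of_nonneg (mul_nonneg hz.le (optimalReturn_nonneg hc θ ω))]
      exact mul_le_mul_of_nonneg_left (hbound _ (mul_pos hc hz)) hz.le
    · refine Eventually.of_forall fun ω => (hlim.comp ?_).const_mul _
      have hz := periodKernel_pos (M := M) (B := B) ω
      refine tendsto_nhdsWithin_iff.2 ⟨?_, ?_⟩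
      · exact (Continuous.tendsto' (continuous_mul_const _) 0 _ (zero_mul _)).mono_left
          nhdsWithin_le_nhds
      · filter_upwards [self_mem_nhdsWithin] with c hc using mul_pos hc hz
    · filter_upwards [self_mem_nhdsWithin] with c hc using hcost c hc

lemma mem_maximizers_of_forall_mem (hB : IsBrownianReal B P) {θ : ℝ} {Y : Ω → ℝ}
    (hY : Y ∈ returns M P B) (h : ∀ ω, Y ω ∈ M.demandSet 0 θ) : Y ∈ maximizers M P B θ := by
  refine ⟨hY, fun Y' hY' => integral_mono_ae (integrable_F_of_mem_returns hB hY' θ)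
    (integrable_F_of_mem_returns hB hY θ) ?_⟩
  filter_upwards [hY'.2.1] with ω hω
  simpa using (h ω).2 _ hω

omit [IsProbabilityMeasure P] [P.IsComplete] in
lemma const_mem_returns (hB : IsBrownianReal B P) {y : ℝ} (hy : 0 ≤ y)
    (hle : y * ∫ ω, periodKernel M B ω ∂P ≤ 1) : (fun _ => y) ∈ returns M P B := by
  refine mem_returns_of_integral_le measurable_const (fun _ => hy)
    ((integrable_periodKernel hB).mul_const y) ?_
  rw [integral_mul_const]
  linarith

lemma Phi_eq_of_mem_demandSet_zero (hB : IsBrownianReal B P) {θ y : ℝ} (hy : y ∈ M.demandSet 0 θ)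
    (hle : y * ∫ ω, periodKernel M B ω ∂P ≤ 1) : Phi M P B θ = M.F y θ := by
  have hmem := const_mem_returns hB hy.1 hle
  have hmax := mem_maximizers_of_forall_mem hB hmem (fun _ => hy)
  have h : objective M P θ (fun _ => y) = M.F y θ := by simp [objective]
  exact le_antisymm (Phi_le fun Y hY => h ▸ hmax.2 hY) (h ▸ objective_le_Phi hB hmem θ)

lemma mul_le_of_isSubgradient_of_mem_demandSet_zero (hB : IsBrownianReal B P) {θ y s : ℝ}
    (hs : IsSubgradient (Phi M P B) θ s) (hy : y ∈ M.demandSet 0 θ)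
    (hle : y * ∫ ω, periodKernel M B ω ∂P ≤ 1) {c : ℝ} (hc : 0 < c) (η : ℝ) :
    s * η ≤ η * (∫ ω, optimalReturn M B c (θ + η) ω ^ M.α ∂P) -
      c * (∫ ω, periodKernel M B ω * optimalReturn M B c (θ + η) ω ∂P) + c := by
  have h1 := mul_le_of_isSubgradient hB hs hc η
  have hF := integrable_F_optimalReturn (M := M) hB hc (θ + η) θ
  have hZ := (integrable_periodKernel_mul_optimalReturn (M := M) hB hc (θ + η)).const_mul c
  have h2 : ∫ ω, M.F (optimalReturn M B c (θ + η) ω) θ ∂P ≤ M.F y θ := by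
    have h3 : ∫ ω, M.F (optimalReturn M B c (θ + η) ω) θ ∂P ≤ ∫ _ω, M.F y θ ∂P :=
      integral_mono hF (integrable_const _) fun ω => by
        simpa using hy.2 _ (optimalReturn_nonneg (M := M) (B := B) hc (θ + η) ω)
    simpa using h3
  rw [integral_sub hF hZ, integral_const_mul, Phi_eq_of_mem_demandSet_zero hB hy hle] at h1
  linarith

omit [MeasurableSpace Ω] in
/-- The prices `|η| μ` and preferences `θ + η` tend to the free good with preference `θ`. -/
lemma optimalReturn_perturbation {θ μ : ℝ} (hθ : θ < -1) (hμ : 0 < μ) :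
    ∃ C, 0 ≤ C ∧ ∀ᶠ η in 𝓝[≠] (0 : ℝ), 0 < |η| * μ ∧
      ∀ ω, optimalReturn M B (|η| * μ) (θ + η) ω ≤ C := by
  have hkγ : 0 ≤ M.k * M.γ ^ M.α := mul_nonneg M.k_nonneg (Real.rpow_nonneg M.γ_pos.le _)
  -- The number `(θ - 1) / 2` is the midpoint of `θ` and `-1`; it bounds `θ + η` away from `-1` for
  -- small `η`.
  refine ⟨(M.k * M.γ ^ M.α / (-1 - (θ - 1) / 2)) ^ (1 / M.α),
    Real.rpow_nonneg (div_nonneg hkγ (by linarith)) _, ?_⟩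
  have h1 : ∀ᶠ η in 𝓝[≠] (0 : ℝ), η < (-1 - θ) / 2 :=
    nhdsWithin_le_nhds (gt_mem_nhds (by linarith))
  filter_upwards [h1, self_mem_nhdsWithin] with η h2 h3
  have h4 : 0 < |η| * μ := mul_pos (abs_pos.2 h3) hμ
  exact ⟨h4, fun ω => M.le_of_mem_demandSet_of_lt_neg_one
    (mul_pos h4 (periodKernel_pos ω)).le (by linarith) (by linarith) (optimalReturn_mem h4 _ ω)⟩

lemma tendsto_abs_mul_mul (μ z : ℝ) : Tendsto (fun η : ℝ => |η| * μ * z) (𝓝[≠] 0) (𝓝 0) :=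
  (Continuous.tendsto' (by fun_prop) 0 _ (by simp)).mono_left nhdsWithin_le_nhds

lemma tendsto_const_add_nhdsNE (θ : ℝ) : Tendsto (fun η : ℝ => θ + η) (𝓝[≠] 0) (𝓝 θ) :=
  (Continuous.tendsto' (by fun_prop) 0 _ (by simp)).mono_left nhdsWithin_le_nhds

lemma nhdsGT_le_nhdsNE : 𝓝[>] (0 : ℝ) ≤ 𝓝[≠] 0 := nhdsWithin_mono _ fun _ h => ne_of_gt h

lemma nhdsLT_le_nhdsNE : 𝓝[<] (0 : ℝ) ≤ 𝓝[≠] 0 := nhdsWithin_mono _ fun _ h => ne_of_lt h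

/-- The subgradient when the budget constraint is slack and `F(·; θ)` has one maximizer. -/
lemma eq_rpow_of_slack (hB : IsBrownianReal B P) {θ y s : ℝ} (hθ : θ < -1)
    (hs : IsSubgradient (Phi M P B) θ s) (hy : y ∈ M.demandSet 0 θ)
    (hle : y * ∫ ω, periodKernel M B ω ∂P ≤ 1) (huniq : ∀ z ∈ M.demandSet 0 θ, z = y) :
    s = y ^ M.α := by
  have hα := M.α_pos
  -- The multiplier `c = |η| μ` vanishes with `η`, and its contribution `+c` to the dual bound
  -- becomes an error `μ` after division by `|η|`.
  have key : ∀ μ : ℝ, 0 < μ → s ≤ y ^ M.α + μ ∧ y ^ M.α ≤ s + μ := by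
    intro μ hμ
    obtain ⟨C, hC0, hC⟩ := optimalReturn_perturbation (M := M) (B := B) hθ hμ
    have hlim : Tendsto (fun η => ∫ ω, optimalReturn M B (|η| * μ) (θ + η) ω ^ M.α ∂P) (𝓝[≠] 0)
        (𝓝 (y ^ M.α)) := by
      have : ∫ _ω : Ω, y ^ M.α ∂P = y ^ M.α := by simp
      rw [← this]
      refine tendsto_integral_filter_of_dominated_convergence (fun _ => C ^ M.α) ?_ ?_
        (integrable_const _) ?_
      · filter_upwards [hC] with η hη
        exact (integrable_optimalReturn_rpow hB hη.1 _).aestronglyMeasurable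
      · filter_upwards [hC] with η hη
        refine Eventually.of_forall fun ω => ?_
        have h0 := optimalReturn_nonneg (M := M) (B := B) hη.1 (θ + η) ω
        rw [Real.norm_of_nonneg (Real.rpow_nonneg h0 _)]
        exact Real.rpow_le_rpow h0 (hη.2 ω) hα.le
      · refine Eventually.of_forall fun ω => Tendsto.rpow_const ?_ (Or.inr hα.le)
        exact M.tendsto_of_subsingleton (tendsto_abs_mul_mul μ (periodKernel M B ω))
          (tendsto_const_add_nhdsNE θ)
          (hC.mono fun η hη => optimalReturn_mem hη.1 _ ω) (hC.mono fun η hη => hη.2 ω) huniq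
    have hcost : ∀ {c θ' : ℝ}, 0 < c →
        0 ≤ ∫ ω, periodKernel M B ω * optimalReturn M B c θ' ω ∂P := fun hc =>
      integral_nonneg fun ω => mul_nonneg (periodKernel_pos ω).le (optimalReturn_nonneg hc _ ω)
    constructor
    · refine ge_of_tendsto ((hlim.mono_left nhdsGT_le_nhdsNE).add_const μ) ?_
      filter_upwards [nhdsGT_le_nhdsNE hC, self_mem_nhdsWithin] with η hη hη0
      have hη0' : 0 < η := hη0
      have h1 := mul_le_of_isSubgradient_of_mem_demandSet_zero hB hs hy hle hη.1 η
      have h2 := mul_nonneg hη.1.le (hcost (θ' := θ + η) hη.1)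
      have h3 : |η| * μ = η * μ := by rw [abs_of_pos hη0']
      by_contra! hlt
      nlinarith
    · refine le_of_tendsto (hlim.mono_left nhdsLT_le_nhdsNE) ?_
      filter_upwards [nhdsLT_le_nhdsNE hC, self_mem_nhdsWithin] with η hη hη0
      have hη0' : η < 0 := hη0
      have h1 := mul_le_of_isSubgradient_of_mem_demandSet_zero hB hs hy hle hη.1 η
      have h2 := mul_nonneg hη.1.le (hcost (θ' := θ + η) hη.1)
      have h3 : |η| * μ = -η * μ := by rw [abs_of_neg hη0']
      by_contra! hlt
      nlinarith
  exact le_antisymm (le_of_forall_pos_le_add fun μ hμ => (key μ hμ).1)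
    (le_of_forall_pos_le_add fun μ hμ => (key μ hμ).2)

/-- A bound for the subgradient when the budget constraint is slack and `F(·; θ)` has the two
maximizers `0` and `y`. -/
lemma le_integral_of_slack (hB : IsBrownianReal B P) {θ y s μ : ℝ} (hθ : θ < -1)
    (hs : IsSubgradient (Phi M P B) θ s) (h0 : 0 ∈ M.demandSet 0 θ)
    (hK : ∀ z ∈ M.demandSet 0 θ, z = 0 ∨ z = y) (hμ : 0 < μ) :
    s ≤ (∫ ω, max (y ^ M.α - μ * (periodKernel M B ω * y)) 0 ∂P) + μ := by
  have hα := M.α_pos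
  obtain ⟨C, hC0, hC⟩ := optimalReturn_perturbation (M := M) (B := B) hθ hμ
  replace hC := hC.filter_mono nhdsGT_le_nhdsNE
  have hZm := measurable_periodKernel (M := M) hB
  -- The demand may accumulate at `0` or at `y`. Taking the maximum with the larger of the two
  -- limiting values makes the integrand converge without deciding which occurs.
  have hlim : Tendsto (fun η => ∫ ω, max
      (optimalReturn M B (|η| * μ) (θ + η) ω ^ M.α -
        μ * (periodKernel M B ω * optimalReturn M B (|η| * μ) (θ + η) ω))
      (max (y ^ M.α - μ * (periodKernel M B ω * y)) 0) ∂P) (𝓝[>] 0)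
      (𝓝 (∫ ω, max (y ^ M.α - μ * (periodKernel M B ω * y)) 0 ∂P)) := by
    refine tendsto_integral_filter_of_dominated_convergence
      (fun ω => C ^ M.α + |y ^ M.α| + μ * (periodKernel M B ω * |y|)) ?_ ?_
      ((integrable_const _).add (((integrable_periodKernel hB).mul_const _).const_mul μ)) ?_
    · filter_upwards [hC] with η hη
      have := measurable_optimalReturn (M := M) hB hη.1 (θ + η)
      exact Measurable.aestronglyMeasurable (by fun_prop)
    · filter_upwards [hC] with η hη
      refine Eventually.of_forall fun ω => ?_
      have hz := periodKernel_pos (M := M) (B := B) ω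
      have h1 := optimalReturn_nonneg (M := M) (B := B) hη.1 (θ + η) ω
      have h2 := Real.rpow_le_rpow h1 (hη.2 ω) hα.le
      have h3 : 0 ≤ μ * (periodKernel M B ω * |y|) := by positivity
      have h4 := abs_nonneg (y ^ M.α)
      have h5 := Real.rpow_nonneg hC0 M.α
      rw [Real.norm_of_nonneg (le_max_of_le_right (le_max_right _ _))]
      refine max_le ?_ (max_le ?_ (by linarith))
      · have := mul_nonneg hμ.le (mul_nonneg hz.le h1)
        linarith
      · have h6 := neg_abs_le y
        have h7 : μ * (periodKernel M B ω * (-|y|)) ≤ μ * (periodKernel M B ω * y) := by gcongr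
        linarith [le_abs_self (y ^ M.α)]
    · refine Eventually.of_forall fun ω => ?_
      refine tendsto_order.2 ⟨fun a ha => Eventually.of_forall fun η => lt_max_of_lt_right ha,
        fun a ha => ?_⟩
      have h1 := M.eventually_lt_of_forall_mem_demandSet
        ((tendsto_abs_mul_mul μ (periodKernel M B ω)).mono_left nhdsGT_le_nhdsNE)
        ((tendsto_const_add_nhdsNE θ).mono_left nhdsGT_le_nhdsNE)
        (hC.mono fun η hη => optimalReturn_mem hη.1 _ ω) (hC.mono fun η hη => hη.2 ω)
        (v := fun z => z ^ M.α - μ * (periodKernel M B ω * z)) (m := a)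
        ((continuous_id.rpow_const fun _ => Or.inr hα.le).sub (by fun_prop)) (fun z hz => ?_)
      · filter_upwards [h1] with η hη using max_lt hη ha
      · rcases hK z hz with rfl | rfl
        · simpa [Real.zero_rpow hα.ne'] using (le_max_right _ _).trans_lt ha
        · exact (le_max_left _ _).trans_lt ha
  refine ge_of_tendsto (hlim.add_const μ) ?_
  filter_upwards [hC, self_mem_nhdsWithin] with η hη hη0
  have hη0' : 0 < η := hη0
  have h1 := mul_le_of_isSubgradient_of_mem_demandSet_zero hB hs h0 (by simp) hη.1 η
  have hi1 := integrable_optimalReturn_rpow (M := M) hB hη.1 (θ + η)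
  have hi2 := (integrable_periodKernel_mul_optimalReturn (M := M) hB hη.1 (θ + η)).const_mul μ
  have hi3 : Integrable (fun ω => max (y ^ M.α - μ * (periodKernel M B ω * y)) 0) P :=
    ((integrable_const _).sub (((integrable_periodKernel hB).mul_const y).const_mul μ)).pos_part
  have h2 : (∫ ω, optimalReturn M B (|η| * μ) (θ + η) ω ^ M.α ∂P) -
      μ * (∫ ω, periodKernel M B ω * optimalReturn M B (|η| * μ) (θ + η) ω ∂P) ≤ ∫ ω, max
      (optimalReturn M B (|η| * μ) (θ + η) ω ^ M.α -
        μ * (periodKernel M B ω * optimalReturn M B (|η| * μ) (θ + η) ω))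
      (max (y ^ M.α - μ * (periodKernel M B ω * y)) 0) ∂P := by
    rw [← integral_const_mul, ← integral_sub hi1 hi2]
    exact integral_mono (hi1.sub hi2) ((hi1.sub hi2).sup hi3) fun ω => le_max_left _ _
  rw [abs_of_pos hη0'] at *
  by_contra! hlt
  nlinarith

/-- The case of a slack budget constraint. -/
lemma exists_maximizer_of_cost_le_one (hB : IsBrownianReal B P) {θ s : ℝ}
    (hθ : 0 ≤ θ ∨ 0 < M.k) (hs : IsSubgradient (Phi M P B) θ s)
    (hcost : ∀ c, 0 < c → ∫ ω, periodKernel M B ω * optimalReturn M B c θ ω ∂P ≤ 1) :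
    ∃ Y ∈ maximizers M P B θ, ∫ ω, Y ω ^ M.α ∂P = s := by
  have hα := M.α_pos
  have hZ := integrable_periodKernel (M := M) hB
  obtain ⟨y₀, hy₀, hleast, hafford⟩ := exists_least_of_cost_le_one hB hcost
  have hθ1 := M.lt_neg_one_of_mem_demandSet_zero hθ hy₀
  by_cases huniq : ∀ z ∈ M.demandSet 0 θ, z = y₀
  · refine ⟨fun _ => y₀, mem_maximizers_of_forall_mem hB (const_mem_returns hB hy₀.1 hafford)
      fun _ => hy₀, ?_⟩
    simp [eq_rpow_of_slack hB hθ1 hs hy₀ hafford huniq]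
  push Not at huniq
  obtain ⟨y, hy, hne⟩ := huniq
  have hypos : 0 < y := (hy₀.1).trans_lt (lt_of_le_of_ne (hleast y hy) hne.symm)
  have h00 : y₀ = 0 := by
    by_contra h
    exact hne (M.eq_of_mem_demandSet_zero hypos hy (lt_of_le_of_ne hy₀.1 (Ne.symm h)) hy₀)
  subst h00
  have hK : ∀ z ∈ M.demandSet 0 θ, z = 0 ∨ z = y := fun z hz => by
    rcases hz.1.eq_or_lt with h | h
    · exact Or.inl h.symm
    · exact Or.inr (M.eq_of_mem_demandSet_zero h hz hypos hy)
  have hstar := fun μ (hμ : 0 < μ) => le_integral_of_slack hB hθ1 hs hy₀ hK hμ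
  set a := y ^ M.α with ha
  have ha0 : 0 < a := Real.rpow_pos_of_pos hypos _
  have hs0 := hs.nonneg (Phi_mono hB)
  set q : ℝ → ℝ := fun t => ∫ ω, (if periodKernel M B ω ≤ t then (1 : ℝ) else 0) ∂P with hq
  set X : ℝ → ℝ := fun t => ∫ ω, (if periodKernel M B ω ≤ t then periodKernel M B ω else 0) ∂P
    with hX
  have hqc : Continuous q := continuous_integral_ite hB (integrable_const 1)
  have hqlim : Tendsto q atTop (𝓝 1) := by
    simpa using tendsto_integral_ite (M := M) hB (integrable_const (μ := P) (1 : ℝ))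
  have hXlim : Tendsto X atTop (𝓝 (∫ ω, periodKernel M B ω ∂P)) := tendsto_integral_ite hB hZ
  have hq1 : ∀ t, q t ≤ 1 := fun t => by
    have : q t ≤ ∫ _ω : Ω, (1 : ℝ) ∂P := integral_mono (integrable_ite hB (integrable_const 1) t)
      (integrable_const 1) fun ω => by dsimp only; split_ifs <;> norm_num
    simpa using this
  -- the bound for the subgradient is a budget constraint in disguise
  have hbudget : ∀ t, 0 < t → a * q t ≤ s → y * X t ≤ 1 := by
    intro t ht hts
    -- For `μ = a / (y t)` the positive part in the bound is `(a / t) (t - Z_τ)⁺`, supported on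
    -- `{Z_τ ≤ t}`.
    have hμ : 0 < a / (y * t) := by positivity
    have h1 := hstar _ hμ
    have h2 : ∫ ω, max (a - a / (y * t) * (periodKernel M B ω * y)) 0 ∂P =
        a * q t - a / t * X t := by
      rw [hq, hX, ← integral_const_mul, ← integral_const_mul, ← integral_sub
        ((integrable_ite hB (integrable_const 1) t).const_mul a)
        ((integrable_ite hB hZ t).const_mul (a / t))]
      refine integral_congr_ae (Eventually.of_forall fun ω => ?_)
      have e : a - a / (y * t) * (periodKernel M B ω * y) =
          a / t * (t - periodKernel M B ω) := by field_simp
      dsimp only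
      rw [e]
      split_ifs with h
      · rw [max_eq_left (mul_nonneg (by positivity) (by linarith))]
        field_simp
      · rw [max_eq_right (mul_nonpos_of_nonneg_of_nonpos (by positivity) (by linarith))]
        ring
    rw [h2] at h1
    have h3 : a / t * X t ≤ a / (y * t) := by linarith
    have h4 : a / t * X t ≤ a / t * (1 / y) := h3.trans_eq (by field_simp)
    have h5 := le_of_mul_le_mul_left h4 (by positivity)
    rw [le_div_iff₀ hypos] at h5
    linarith
  have hsa : s ≤ a := by
    refine le_of_forall_pos_le_add fun μ hμ => (hstar μ hμ).trans ?_
    have h1 : ∫ ω, max (a - μ * (periodKernel M B ω * y)) 0 ∂P ≤ ∫ _ω : Ω, a ∂P := by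
      refine integral_mono ((integrable_const _).sub
        ((hZ.mul_const y).const_mul μ)).pos_part (integrable_const a) fun ω => ?_
      have hz := periodKernel_pos (M := M) (B := B) ω
      have : 0 ≤ μ * (periodKernel M B ω * y) := by positivity
      exact max_le (by linarith) ha0.le
    have h2 : ∫ _ω : Ω, a ∂P = a := by simp
    linarith
  -- The extreme slopes `s = a` and `s = 0` correspond to the constant returns `y` and `0`;
  -- intermediate slopes need a finite threshold `t > 0`.
  rcases hsa.eq_or_lt with heq | hlt
  · have h1 : y * ∫ ω, periodKernel M B ω ∂P ≤ 1 := by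
      refine le_of_tendsto (hXlim.const_mul y) ?_
      filter_upwards [eventually_gt_atTop 0] with t ht
      refine hbudget t ht ?_
      rw [heq]
      exact mul_le_of_le_one_right ha0.le (hq1 t)
    refine ⟨fun _ => y, mem_maximizers_of_forall_mem hB (const_mem_returns hB hy.1 h1)
      fun _ => hy, ?_⟩
    simp [heq, ha]
  rcases hs0.eq_or_lt with heq | hspos
  · refine ⟨fun _ => 0, mem_maximizers_of_forall_mem hB (const_mem_returns hB le_rfl (by simp))
      fun _ => hy₀, ?_⟩
    simp [← heq, Real.zero_rpow hα.ne']
  have hq0 : ∀ t, t ≤ 0 → q t = 0 := fun t ht => by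
    have : ∀ ω, ¬ periodKernel M B ω ≤ t := fun ω => by
      have := periodKernel_pos (M := M) (B := B) ω
      linarith
    simp [hq, this]
  have hsa1 : s / a < 1 := (div_lt_one ha0).2 hlt
  obtain ⟨T, hT⟩ := (hqlim.eventually (lt_mem_nhds hsa1)).exists
  -- Since `Z_τ` has no atoms, its distribution function `q` is continuous and some threshold
  -- satisfies `a q(t) = s`. The return `y` on `{Z_τ ≤ t}` then has `α`-moment `s` and is affordable
  -- by `hbudget`.
  obtain ⟨t, ht⟩ : s / a ∈ range q := mem_range_of_exists_le_of_exists_ge hqc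
    ⟨0, by rw [hq0 0 le_rfl]; positivity⟩ ⟨T, hT.le⟩
  have htpos : 0 < t := by
    by_contra! h
    rw [hq0 t h] at ht
    have : 0 < s / a := by positivity
    linarith
  have haq : a * q t = s := by rw [ht]; field_simp
  have hset : MeasurableSet[augmentedSigma P B M.τ.toNNReal] {ω | periodKernel M B ω ≤ t} :=
    measurable_augmentedSigma_periodKernel hB measurableSet_Iic
  have e1 : (fun ω => periodKernel M B ω * if periodKernel M B ω ≤ t then y else 0) =
      fun ω => y * if periodKernel M B ω ≤ t then periodKernel M B ω else 0 := by
    funext ω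
    split_ifs <;> ring
  have hmem : (fun ω => if periodKernel M B ω ≤ t then y else 0) ∈ returns M P B := by
    refine mem_returns_of_integral_le ?_ (fun ω => ?_) ?_ ?_
    · exact Measurable.ite hset measurable_const measurable_const
    · split_ifs
      exacts [hypos.le, le_rfl]
    · rw [e1]
      exact (integrable_ite hB hZ t).const_mul y
    · rw [e1, integral_const_mul]
      exact hbudget t htpos haq.le
  refine ⟨_, mem_maximizers_of_forall_mem hB hmem fun ω => ?_, ?_⟩
  · split_ifs
    exacts [hy, hy₀]
  · rw [← haq, hq, ← integral_const_mul]
    refine integral_congr_ae (Eventually.of_forall fun ω => ?_)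
    by_cases h : periodKernel M B ω ≤ t
    · simp [h, ha]
    · simp [h, Real.zero_rpow hα.ne']

/-- Every subgradient of the value function comes from a maximizer. -/
lemma exists_maximizer_of_isSubgradient (hB : IsBrownianReal B P) {θ s : ℝ}
    (hθ : 0 ≤ θ ∨ 0 < M.k) (hs : IsSubgradient (Phi M P B) θ s) :
    ∃ Y ∈ maximizers M P B θ, ∫ ω, Y ω ^ M.α ∂P = s := by
  by_cases h : ∃ c, 0 < c ∧ ∫ ω, periodKernel M B ω * optimalReturn M B c θ ω ∂P = 1
  · obtain ⟨c, hc, hcost⟩ := h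
    exact exists_maximizer_of_cost_eq_one hB hs hc hcost
  -- The cost is continuous in the multiplier and below `1` for large multipliers, so if it never
  -- equals `1` it never exceeds `1`.
  refine exists_maximizer_of_cost_le_one hB hθ hs fun c hc => ?_
  by_contra! hlt
  obtain ⟨c₀, hc₀⟩ := exists_cost_lt_one (M := M) hB θ
  obtain ⟨c', hc', h1⟩ := isPreconnected_Ioi.intermediate_value
    (mem_Ioi.2 (hc₀ c₀ le_rfl).1) (mem_Ioi.2 hc) (continuousOn_cost (M := M) hB θ)
    ⟨(hc₀ c₀ le_rfl).2.le, hlt.le⟩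
  exact h ⟨c', hc', h1⟩

end Slack

lemma Model.disc_pos (M : Model) : 0 < M.disc := Real.exp_pos _

lemma Model.disc_mul_exp_lt_one (M : Model) : M.disc * Real.exp (M.h * M.τ) < 1 := by
  have h : M.h < M.δ := M.well_posed
  rw [Model.disc, ← Real.exp_add, Real.exp_lt_one_iff]
  nlinarith [M.τ_pos]

lemma Model.weight_mem_Icc (M : Model) {β ξ : ℝ} (hβ : β ∈ Ioc (0 : ℝ) 1)
    (hξ : ξ ≤ Real.exp (M.h * M.τ)) :
    0 < 1 - (1 - β) * M.disc * ξ ∧ M.weight β ξ ∈ Icc (0 : ℝ) 1 ∧ 0 < M.weight β ξ := by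
  have hβ0 := hβ.1
  have h1 := le_one_sub_mul M.disc_pos.le M.disc_mul_exp_lt_one hβ.2 hξ
  have h2 : 0 < 1 - (1 - β) * M.disc * ξ := by linarith
  have h3 : 0 < M.weight β ξ := div_pos hβ0 h2
  exact ⟨h2, ⟨h3.le, (div_le_one h2).2 h1⟩, h3⟩

/-! ### Fixed points of `G` and comparison in `β` -/

section Sophisticated

variable {Ω : Type*} [MeasurableSpace Ω] {P : Measure Ω} {B : ℝ≥0 → Ω → ℝ} {M : Model}
  [IsProbabilityMeasure P] [P.IsComplete]

lemma continuous_Phi (hB : IsBrownianReal B P) : Continuous (Phi M P B) :=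
  (lipschitzWith_of_monotone (Phi_mono hB) (Real.exp_pos _).le
    fun _ _ h => Phi_add_le hB h).continuous

lemma neg_le_Phi (hB : IsBrownianReal B P) (θ : ℝ) : -(M.k * M.γ ^ M.α) ≤ Phi M P B θ := by
  simpa using le_Phi (M := M) hB θ

lemma thetaStar_eq (hB : IsBrownianReal B P) {κ : ℝ} (hκ : κ ∈ Icc (0 : ℝ) 1) :
    thetaStar M P B κ = M.disc * Phi M P B (κ * thetaStar M P B κ) :=
  Classical.epsilon_spec (exists_eq_mul_comp (Phi_mono hB) (Real.exp_pos _).le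
    (fun _ _ h => Phi_add_le hB h) M.disc_pos.le M.disc_mul_exp_lt_one hκ)

lemma eq_thetaStar (hB : IsBrownianReal B P) {κ θ : ℝ} (hκ : κ ∈ Icc (0 : ℝ) 1)
    (hθ : θ = M.disc * Phi M P B (κ * θ)) : θ = thetaStar M P B κ :=
  eq_of_eq_mul_comp (fun _ _ h => Phi_add_le hB h) (Real.exp_pos _).le M.disc_pos.le
    M.disc_mul_exp_lt_one hκ hθ (thetaStar_eq hB hκ)

lemma thetaStar_pos (hB : IsBrownianReal B P) (h0 : 0 < Phi M P B 0) {κ : ℝ}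
    (hκ : κ ∈ Icc (0 : ℝ) 1) : 0 < thetaStar M P B κ :=
  pos_of_eq_mul_comp (fun _ _ h => Phi_add_le hB h) (Real.exp_pos _).le M.disc_pos
    M.disc_mul_exp_lt_one hκ (thetaStar_eq hB hκ) h0

lemma thetaStar_neg (hB : IsBrownianReal B P) (h0 : Phi M P B 0 < 0) {κ : ℝ}
    (hκ : κ ∈ Icc (0 : ℝ) 1) : thetaStar M P B κ < 0 :=
  neg_of_eq_mul_comp (fun _ _ h => Phi_add_le hB h) (Real.exp_pos _).le M.disc_pos
    M.disc_mul_exp_lt_one hκ (thetaStar_eq hB hκ) h0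

lemma Theta_pos (hB : IsBrownianReal B P) (h0 : 0 < Phi M P B 0) {β ξ : ℝ}
    (hβ : β ∈ Ioc (0 : ℝ) 1) (hξ : ξ ∈ fixedPointsG M P B β) : 0 < Theta M P B β ξ := by
  obtain ⟨-, h1, h2⟩ := M.weight_mem_Icc hβ hξ.1.2
  exact mul_pos h2 (thetaStar_pos hB h0 h1)

lemma Theta_neg (hB : IsBrownianReal B P) (h0 : Phi M P B 0 < 0) {β ξ : ℝ}
    (hβ : β ∈ Ioc (0 : ℝ) 1) (hξ : ξ ∈ fixedPointsG M P B β) : Theta M P B β ξ < 0 := by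
  obtain ⟨-, h1, h2⟩ := M.weight_mem_Icc hβ hξ.1.2
  exact mul_neg_of_pos_of_neg h2 (thetaStar_neg hB h0 h1)

lemma Theta_mul_eq (hB : IsBrownianReal B P) {β ξ : ℝ} (hβ : β ∈ Ioc (0 : ℝ) 1)
    (hξ : ξ ≤ Real.exp (M.h * M.τ)) :
    Theta M P B β ξ * (1 - (1 - β) * M.disc * ξ) = β * M.disc * Phi M P B (Theta M P B β ξ) := by
  obtain ⟨h0, h1, -⟩ := M.weight_mem_Icc hβ hξ
  have h2 := thetaStar_eq (M := M) hB h1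
  have h3 : M.weight β ξ * (1 - (1 - β) * M.disc * ξ) = β := div_mul_cancel₀ _ h0.ne'
  rw [mul_assoc β, Theta, ← h2]
  calc _ = M.weight β ξ * (1 - (1 - β) * M.disc * ξ) * thetaStar M P B (M.weight β ξ) := by ring
    _ = _ := by rw [h3]

lemma Theta_eq_of_mul_eq (hB : IsBrownianReal B P) {β ξ θ : ℝ} (hβ : β ∈ Ioc (0 : ℝ) 1)
    (hξ : ξ ≤ Real.exp (M.h * M.τ))
    (h : θ * (1 - (1 - β) * M.disc * ξ) = β * M.disc * Phi M P B θ) : Theta M P B β ξ = θ := by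
  obtain ⟨h0, h1, -⟩ := M.weight_mem_Icc hβ hξ
  have h2 : M.weight β ξ * (M.disc * Phi M P B θ) = θ := by
    rw [Model.weight, div_mul_eq_mul_div, ← mul_assoc, ← h, mul_div_cancel_right₀ _ h0.ne']
  have h3 := eq_thetaStar (θ := M.disc * Phi M P B θ) hB h1 (by rw [h2])
  rw [Theta, ← h3, h2]

lemma isSubgradient_of_mem_fixedPointsG (hB : IsBrownianReal B P) {β ξ : ℝ}
    (hξ : ξ ∈ fixedPointsG M P B β) : IsSubgradient (Phi M P B) (Theta M P B β ξ) ξ := by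
  obtain ⟨-, Y, hY, hYξ⟩ := hξ
  have hYξ' : ∫ ω, Y ω ^ M.α ∂P = ξ := hYξ
  intro θ'
  have := subgradient_of_mem_maximizers hB hY θ'
  rwa [hYξ'] at this

/-- The equation identifies `θ` with `Theta` by uniqueness of `θ*`, and the subgradient `ξ` is
realized by a maximizer. -/
lemma mem_fixedPointsG (hB : IsBrownianReal B P) {β ξ θ : ℝ} (hβ : β ∈ Ioc (0 : ℝ) 1)
    (hθ : 0 ≤ θ ∨ 0 < M.k) (hs : IsSubgradient (Phi M P B) θ ξ)
    (h : θ * (1 - (1 - β) * M.disc * ξ) = β * M.disc * Phi M P B θ) :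
    ξ ∈ fixedPointsG M P B β := by
  have hξ := hs.le fun _ _ h => Phi_add_le hB h
  refine ⟨⟨hs.nonneg (Phi_mono hB), hξ⟩, ?_⟩
  rw [G, Theta_eq_of_mul_eq hB hβ hξ h]
  exact exists_maximizer_of_isSubgradient hB hθ hs

lemma fixedPointsG_nonempty (hB : IsBrownianReal B P) (h0 : Phi M P B 0 < 0) {β : ℝ}
    (hβ : β ∈ Ioc (0 : ℝ) 1) : (fixedPointsG M P B β).Nonempty := by
  -- For `k = 0` the zero return already has value `0`, contrary to `Φ(0) < 0`.
  have hk : 0 < M.k := by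
    refine M.k_nonneg.lt_of_ne fun hk => ?_
    have := neg_le_Phi (M := M) hB 0
    rw [← hk] at this
    linarith
  obtain ⟨θ, ξ, hs, h⟩ := exists_isSubgradient_of_neg (convexOn_Phi hB) (continuous_Phi hB)
    (Phi_mono hB) (fun _ _ h => Phi_add_le hB h)
    (mul_nonneg M.k_nonneg (Real.rpow_nonneg M.γ_pos.le _)) (neg_le_Phi (M := M) hB) M.disc_pos
    M.disc_mul_exp_lt_one hβ h0
  exact ⟨ξ, mem_fixedPointsG hB hβ (Or.inr hk) hs h⟩

lemma Theta_le_of_neg (hB : IsBrownianReal B P) (h0 : Phi M P B 0 < 0) {β₁ β₂ ξ₁ ξ₂ : ℝ}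
    (hβ₁ : β₁ ∈ Ioc (0 : ℝ) 1) (hβ₂ : β₂ ∈ Ioc (0 : ℝ) 1) (hβ : β₁ ≤ β₂)
    (hξ₁ : ξ₁ ∈ fixedPointsG M P B β₁) (hξ₂ : ξ₂ ∈ fixedPointsG M P B β₂) :
    Theta M P B β₂ ξ₂ ≤ Theta M P B β₁ ξ₁ :=
  le_of_isSubgradient_of_neg (fun _ _ h => Phi_add_le hB h) M.disc_pos M.disc_mul_exp_lt_one
    hβ₁ hβ (isSubgradient_of_mem_fixedPointsG hB hξ₁) (isSubgradient_of_mem_fixedPointsG hB hξ₂)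
    (Theta_neg hB h0 hβ₂ hξ₂) (Theta_mul_eq hB hβ₁ hξ₁.1.2) (Theta_mul_eq hB hβ₂ hξ₂.1.2)

/-- The tangent intercept at the solution for `β₂` is nonnegative, so decreasing `β` turns this
solution into a supersolution. The solution for `β₁` found below it must be the one given by the
unique fixed point. -/
lemma Theta_le_of_pos (hB : IsBrownianReal B P) (h0 : 0 < Phi M P B 0) {β₁ β₂ ξ₁ ξ₂ : ℝ}
    (hβ₁ : β₁ ∈ Ioc (0 : ℝ) 1) (hβ₂ : β₂ ∈ Ioc (0 : ℝ) 1) (hβ : β₁ ≤ β₂)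
    (hξ₁ : fixedPointsG M P B β₁ = {ξ₁}) (hξ₂ : ξ₂ ∈ fixedPointsG M P B β₂) :
    Theta M P B β₁ ξ₁ ≤ Theta M P B β₂ ξ₂ := by
  have hs := isSubgradient_of_mem_fixedPointsG hB hξ₂
  have hpos := Theta_pos hB h0 hβ₂ hξ₂
  have heq := Theta_mul_eq (M := M) hB hβ₂ hξ₂.1.2
  set θ₂ := Theta M P B β₂ ξ₂ with hθ₂
  have hle : β₁ * M.disc * Phi M P B θ₂ ≤ θ₂ * (1 - (1 - β₁) * M.disc * ξ₂) := by
    have h2 : 0 ≤ Phi M P B θ₂ - ξ₂ * θ₂ := by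
      -- the intercept is proportional to `θ₂`
      have h3 : β₂ * M.disc * (Phi M P B θ₂ - ξ₂ * θ₂) = θ₂ * (1 - M.disc * ξ₂) := by linarith
      have h4 : M.disc * ξ₂ ≤ M.disc * Real.exp (M.h * M.τ) :=
        mul_le_mul_of_nonneg_left hξ₂.1.2 M.disc_pos.le
      have h5 : 0 ≤ θ₂ * (1 - M.disc * ξ₂) :=
        mul_nonneg hpos.le (by linarith [M.disc_mul_exp_lt_one])
      rw [← h3] at h5
      exact nonneg_of_mul_nonneg_right h5 (mul_pos hβ₂.1 M.disc_pos)
    have h3 := mul_nonneg (mul_nonneg (sub_nonneg.2 hβ) M.disc_pos.le) h2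
    linarith
  obtain ⟨θ, ξ, hsub, hθ0, hθ, h⟩ := exists_isSubgradient_of_pos (convexOn_Phi hB)
    (continuous_Phi hB) (Phi_mono hB) (fun _ _ h => Phi_add_le hB h) (neg_le_Phi (M := M) hB)
    M.disc_pos hβ₁.1 h0 hs hpos hle
  have hmem := mem_fixedPointsG hB hβ₁ (Or.inl hθ0) hsub h
  have hξ : ξ = ξ₁ := by rwa [hξ₁] at hmem
  rw [← hξ, Theta_eq_of_mul_eq hB hβ₁ hmem.1.2 h]
  exact hθ

end Sophisticated

end PeriodicPortfolio

theorem mainTheorem8 {Ω : Type*} [MeasurableSpace Ω] (P : MeasureTheory.Measure Ω)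
    [MeasureTheory.IsProbabilityMeasure P] [P.IsComplete] (B : NNReal → Ω → ℝ)
    (hB : ProbabilityTheory.IsBrownianReal B P) (M : PeriodicPortfolio.Model) :
    (0 < PeriodicPortfolio.AMy M P B →
      MonotoneOn (fun β : ℝ => β * PeriodicPortfolio.AExpo M P B) (Set.Ioc 0 1) ∧
      ∀ β₁ ∈ Set.Ioc (0 : ℝ) 1, ∀ β₂ ∈ Set.Ioc (0 : ℝ) 1, β₁ ≤ β₂ →
        ∀ ξ₁ ξ₂ : ℝ, PeriodicPortfolio.fixedPointsG M P B β₁ = {ξ₁} →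
          PeriodicPortfolio.fixedPointsG M P B β₂ = {ξ₂} →
          PeriodicPortfolio.ASo M P B β₁ ξ₁ ≤ PeriodicPortfolio.ASo M P B β₂ ξ₂) ∧
    (PeriodicPortfolio.AMy M P B < 0 →
      AntitoneOn (fun β : ℝ => β * PeriodicPortfolio.AExpo M P B) (Set.Ioc 0 1) ∧
      (∀ β ∈ Set.Ioc (0 : ℝ) 1, (PeriodicPortfolio.fixedPointsG M P B β).Nonempty) ∧
      ∀ β₁ ∈ Set.Ioc (0 : ℝ) 1, ∀ β₂ ∈ Set.Ioc (0 : ℝ) 1, β₁ ≤ β₂ →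
        ∀ ξ₁ ∈ PeriodicPortfolio.fixedPointsG M P B β₁,
          ∀ ξ₂ ∈ PeriodicPortfolio.fixedPointsG M P B β₂,
          PeriodicPortfolio.ASo M P B β₂ ξ₂ ≤ PeriodicPortfolio.ASo M P B β₁ ξ₁) := by
  have h1 : (1 : ℝ) ∈ Set.Icc (0 : ℝ) 1 := ⟨zero_le_one, le_rfl⟩
  have hd := M.disc_pos
  rw [PeriodicPortfolio.AMy_eq]
  refine ⟨fun h => ?_, fun h => ?_⟩
  · have h0 := pos_of_mul_pos_right h hd.le
    refine ⟨fun β₁ _ β₂ _ hβ => mul_le_mul_of_nonneg_right hβ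
      (PeriodicPortfolio.thetaStar_pos hB h0 h1).le, ?_⟩
    intro β₁ hβ₁ β₂ hβ₂ hβ ξ₁ ξ₂ hξ₁ hξ₂
    exact PeriodicPortfolio.Theta_le_of_pos hB h0 hβ₁ hβ₂ hβ hξ₁ (by rw [hξ₂]; rfl)
  · have h0 : PeriodicPortfolio.Phi M P B 0 < 0 := by
      by_contra! hle
      exact absurd h (not_lt.2 (mul_nonneg hd.le hle))
    refine ⟨fun β₁ _ β₂ _ hβ => mul_le_mul_of_nonpos_right hβ
      (PeriodicPortfolio.thetaStar_neg hB h0 h1).le,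
      fun β hβ => PeriodicPortfolio.fixedPointsG_nonempty hB h0 hβ, ?_⟩
    intro β₁ hβ₁ β₂ hβ₂ hβ ξ₁ hξ₁ ξ₂ hξ₂
    exact PeriodicPortfolio.Theta_le_of_neg hB h0 hβ₁ hβ₂ hβ hξ₁ hξ₂
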